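/- Let $\mathbb K$ be a field. Let $Q=(Q_0,Q_1,s,t)$ be a quiver with finitely many vertices and arrows, graded by a function $|\cdot|:Q_1\to\mathbb Z$ (extended additively to paths); paths are written from right to left. Let $R$ be a set of paths in $Q$ and let $\mathrm{Sp}$ be a set of loops of $Q$, all of degree $0$. Put $S=R\cup\{\varepsilon^2\mid\varepsilon\in\mathrm{Sp}\}$ and assume that $(Q,R,\mathrm{Sp})$ is a graded skew-gentle triple, i.e. that $(Q,S)$ is a gentle pair: every element of $S$ is a path of length $2$; every vertex is the source of at most two arrows and the target of at most two arrows; and for every arrow $\alpha$ there is at most one arrow $\beta$ with $t(\beta)=s(\alpha)$ and $\alpha\beta\in S$, at most one such $\beta$ with $\alpha\beta\notin S$, at most one arrow $\gamma$ with $s(\gamma)=t(\alpha)$ and $\gamma\alpha\in S$, and at most one such $\gamma$ with $\gamma\alpha\notin S$. Let \[A=\mathbb KQ/\langle R\cup\{\varepsilon^2-\varepsilon\mid\varepsilon\in\mathrm{Sp}\}\rangle\] be the corresponding graded skew-gentle algebra, with the $\mathbb Z$-grading induced by the degrees of paths. For $n\ge 0$ let $\Gamma_n$ be the set of paths of length $n$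 in $Q$ all of whose subpaths of length $2$ lie in $S$ (so $\Gamma_0=Q_0$ and $\Gamma_1=Q_1$), and for $n\ge 1$ let $\mathrm{Sp}^n=\{\varepsilon^n\mid\varepsilon\in\mathrm{Sp}\}\subseteq\Gamma_n$; for $\varepsilon\in\mathrm{Sp}$, $\varepsilon^0$ denotes the trivial path at $s(\varepsilon)$. Write $\otimes=\otimes_{\mathbb KQ_0}$, and grade the $A$-bimodule $A\otimes\mathbb K\Gamma_n\otimes A$ by $|a\otimes q\otimes b|=|a|+|q|+|b|$. Then $A$ is a $\mathbb Z$-graded algebra, there are well-defined $A$-bimodule morphisms $d_n:A\otimes\mathbb K\Gamma_n\otimes A\to A\otimes\mathbb K\Gamma_{n-1}\otimes A$ ($n\ge 1$) and $d_0:A\otimes\mathbb K\Gamma_0\otimes A\to A$ with $d_0(1\otimes e\otimes 1)=e$ for $e\in\Gamma_0$ and, for $n\ge1$, \[d_n(1\otimes q\otimes 1)=\begin{cases} a_n\otimes a_{n-1}\cdots a_1\otimes 1+(-1)^n\,1\otimes a_n\cdots a_2\otimes a_1 & \text{if } q=a_n\cdots a_1\in\Gamma_n\setminus\mathrm{Sp}^n,\\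 \varepsilon\otimes\varepsilon^{n-1}\otimes 1-1\otimes\varepsilon^{n-1}\otimes\varepsilon & \text{if } q=\varepsilon^n\in\mathrm{Sp}^n,\ n \text{ odd},\\ \varepsilon\otimes\varepsilon^{n-1}\otimes 1+1\otimes\varepsilon^{n-1}\otimes\varepsilon-1\otimes\varepsilon^{n-1}\otimes 1 & \text{if } q=\varepsilon^n\in\mathrm{Sp}^n,\ n \text{ even}, \end{cases}\] and, with these differentials, \[\cdots\to A\otimes\mathbb K\Gamma_n\otimes A\xrightarrow{d_n}A\otimes\mathbb K\Gamma_{n-1}\otimes A\to\cdots\to A\otimes\mathbb K\Gamma_1\otimes A\xrightarrow{d_1}A\otimes\mathbb K\Gamma_0\otimes A\xrightarrow{d_0}A\to0\] is a graded projective resolution of $A$ as a graded $A$-bimodule: the sequence is exact, every $d_n$ is homogeneous of degree $0$, and every $A\otimes\mathbb K\Gamma_n\otimes A$ is a graded bimodule which is projective both as an $A$-bimodule and in the category of graded $A$-bimodules with morphisms of degree $0$. -/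

import Mathlib

universe uK uV uE w

open scoped TensorProduct

namespace SkewGentle

/-- A quiver `(Q₀, Q₁, s, t)` with vertex set `V` and arrow set `E`. -/
structure Quiv (V : Type uV) (E : Type uE) where
  src : E → V
  tgt : E → V

section Paths

variable {V : Type uV} {E : Type uE}

/-- `Q.IsWalk j w i`: the word `w = [a_l, …, a_1]`, written from right to left as a composition
of functions, is a path `a_l ⋯ a_1` from the vertex `i` to the vertex `j`. -/
def Quiv.IsWalk (Q : Quiv V E) : V → List E → V → Prop
  | j, [], i => j = i
  | j, a :: w, i => Q.tgt a = j ∧ Q.IsWalk (Q.src a) w i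

theorem Quiv.IsWalk.append {Q : Quiv V E} {u v : List E} {k j i : V}
    (hu : Q.IsWalk k u j) (hv : Q.IsWalk j v i) : Q.IsWalk k (u ++ v) i := by
  induction u generalizing k with
  | nil => cases hu; exact hv
  | cons a u ih => exact ⟨hu.1, ih hu.2⟩

/-- A path in `Q`; the trivial path at a vertex has the empty word. -/
@[ext]
structure QPath (Q : Quiv V E) where
  tgt : V
  word : List E
  src : V
  isWalk : Q.IsWalk tgt word src

namespace QPath

variable {Q : Quiv V E}

/-- The length of a path. -/
def length (p : QPath Q) : ℕ := p.word.length

/-- The trivial path `e_i`. -/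
def triv (Q : Quiv V E) (i : V) : QPath Q := ⟨i, [], i, rfl⟩

/-- An arrow as a path of length one. -/
def arrow (Q : Quiv V E) (a : E) : QPath Q := ⟨Q.tgt a, [a], Q.src a, rfl, rfl⟩

/-- The composition `p q` (first `q`, then `p`) of composable paths. -/
def comp (p q : QPath Q) (h : p.src = q.tgt) : QPath Q :=
  ⟨p.tgt, p.word ++ q.word, q.src, p.isWalk.append (h ▸ q.isWalk)⟩

/-- The path `αβ` of length two. -/
def two (α β : E) (h : Q.src α = Q.tgt β) : QPath Q := (arrow Q α).comp (arrow Q β) h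

/-- The path obtained from `a_l ⋯ a_1` by deleting the leftmost arrow `a_l`. -/
def dropLeft : QPath Q → QPath Q
  | ⟨j, [], i, h⟩ => ⟨j, [], i, h⟩
  | ⟨_, a :: w, i, h⟩ => ⟨Q.src a, w, i, h.2⟩

theorem _root_.SkewGentle.Quiv.IsWalk.dropLast {a : E} {w : List E} {j i : V}
    (h : Q.IsWalk j (a :: w) i) :
    Q.IsWalk j (a :: w).dropLast (Q.tgt ((a :: w).getLast (by simp))) := by
  induction w generalizing a j with
  | nil => exact h.1.symm
  | cons b w ih =>
    have := ih h.2
    rw [List.dropLast_cons_cons, List.getLast_cons (by simp)]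
    exact ⟨h.1, this⟩

/-- The path obtained from `a_l ⋯ a_1` by deleting the rightmost arrow `a_1`. -/
def dropRight : QPath Q → QPath Q
  | ⟨j, [], i, h⟩ => ⟨j, [], i, h⟩
  | ⟨j, a :: w, _, h⟩ => ⟨j, (a :: w).dropLast, Q.tgt ((a :: w).getLast (by simp)), h.dropLast⟩

theorem dropLeft_word (p : QPath Q) : p.dropLeft.word = p.word.tail := by
  rcases p with ⟨j, _ | ⟨a, w⟩, i, h⟩ <;> rfl

theorem dropRight_word (p : QPath Q) : p.dropRight.word = p.word.dropLast := by
  rcases p with ⟨j, _ | ⟨a, w⟩, i, h⟩ <;> rfl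

theorem isWalk_replicate {a : E} (h : Q.src a = Q.tgt a) (n : ℕ) :
    Q.IsWalk (Q.tgt a) (List.replicate n a) (Q.src a) := by
  induction n with
  | zero => exact h.symm
  | succ n ih => exact ⟨rfl, h.symm ▸ ih⟩

/-- The power `ε^n` of a loop `ε`; `ε^0` is the trivial path at the vertex of `ε`. -/
def loopPow (ε : E) (h : Q.src ε = Q.tgt ε) (n : ℕ) : QPath Q :=
  ⟨Q.tgt ε, List.replicate n ε, Q.src ε, isWalk_replicate h n⟩

/-- The degree of a path, for a grading `deg` on the arrows. -/
def degree (deg : E → ℤ) (p : QPath Q) : ℤ := (p.word.map deg).sum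

end QPath

/-- Gentle pairs `(Q, R)`. -/
structure IsGentlePair (Q : Quiv V E) (R : Set (QPath Q)) : Prop where
  length_two : ∀ p ∈ R, p.length = 2
  out_le_two : ∀ i : V, {a : E | Q.src a = i}.encard ≤ 2
  in_le_two : ∀ i : V, {a : E | Q.tgt a = i}.encard ≤ 2
  rel_right : ∀ (α β β' : E) (h : Q.src α = Q.tgt β) (h' : Q.src α = Q.tgt β'),
    QPath.two α β h ∈ R → QPath.two α β' h' ∈ R → β = β'
  rel_left : ∀ (α γ γ' : E) (h : Q.src γ = Q.tgt α) (h' : Q.src γ' = Q.tgt α),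
    QPath.two γ α h ∈ R → QPath.two γ' α h' ∈ R → γ = γ'
  nonrel_right : ∀ (α β β' : E) (h : Q.src α = Q.tgt β) (h' : Q.src α = Q.tgt β'),
    QPath.two α β h ∉ R → QPath.two α β' h' ∉ R → β = β'
  nonrel_left : ∀ (α γ γ' : E) (h : Q.src γ = Q.tgt α) (h' : Q.src γ' = Q.tgt α),
    QPath.two γ α h ∉ R → QPath.two γ' α h' ∉ R → γ = γ'

/-- The set `Sp^n = {ε^n | ε ∈ Sp}` of `n`-th powers of loops in `Sp`. -/
def spPowers (Q : Quiv V E) (Sp : Set E) (n : ℕ) : Set (QPath Q) :=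
  {p | ∃ ε ∈ Sp, ∃ h : Q.src ε = Q.tgt ε, p = QPath.loopPow ε h n}

end Paths

/-- A graded skew-gentle triple `(Q, R, Sp)`. The special loops have degree `0`, which is
what makes the relations `ε² - ε` homogeneous. -/
structure Triple (V : Type uV) (E : Type uE) where
  Q : Quiv V E
  deg : E → ℤ
  R : Set (QPath Q)
  Sp : Set E
  loop : ∀ ε ∈ Sp, Q.src ε = Q.tgt ε
  gentle : IsGentlePair Q (R ∪ spPowers Q Sp 2)
  deg_special : ∀ ε ∈ Sp, deg ε = 0

noncomputable section

/-! ### The path algebra -/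

section PathAlgebra

variable (K : Type uK) [Field K] {V : Type uV} {E : Type uE}

/-- The path algebra `K Q`: the vector space with basis the paths of `Q`. -/
def PathAlgebra (Q : Quiv V E) : Type (max uK uV uE) := QPath Q →₀ K

namespace PathAlgebra

variable {K} {Q : Quiv V E}

instance : AddCommGroup (PathAlgebra K Q) := inferInstanceAs (AddCommGroup (QPath Q →₀ K))
instance : Module K (PathAlgebra K Q) := inferInstanceAs (Module K (QPath Q →₀ K))

variable (K) in
/-- The basis element of the path algebra given by a path. -/
def ofPath (p : QPath Q) : PathAlgebra K Q := Finsupp.single p 1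

theorem hom_ext {M : Type*} [AddCommGroup M] [Module K M] {f g : PathAlgebra K Q →ₗ[K] M}
    (h : ∀ p, f (ofPath K p) = g (ofPath K p)) : f = g :=
  Finsupp.lhom_ext' fun p => LinearMap.ext_ring (h p)

/-- Extend a function on paths linearly. -/
def extend {M : Type*} [AddCommGroup M] [Module K M] (f : QPath Q → M) :
    PathAlgebra K Q →ₗ[K] M := Finsupp.linearCombination K f

@[simp] theorem extend_ofPath {M : Type*} [AddCommGroup M] [Module K M] (f : QPath Q → M)
    (p : QPath Q) : extend (K := K) f (ofPath K p) = f p :=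
  (Finsupp.linearCombination_single K 1 p).trans (one_smul K _)

open Classical in
/-- The product of two paths: their composition, or `0` if they are not composable. -/
def pathMul (p q : QPath Q) : PathAlgebra K Q :=
  if h : p.src = q.tgt then ofPath K (p.comp q h) else 0

/-- The bilinear multiplication. -/
def mulₗ : PathAlgebra K Q →ₗ[K] PathAlgebra K Q →ₗ[K] PathAlgebra K Q :=
  extend fun p => extend fun q => pathMul p q

instance : Mul (PathAlgebra K Q) := ⟨fun x y => mulₗ x y⟩

theorem mul_def (x y : PathAlgebra K Q) : x * y = mulₗ x y := rfl

theorem ofPath_mul (p q : QPath Q) : ofPath K p * ofPath K q = pathMul p q := by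
  simp [mul_def, mulₗ]

theorem mul_ofPath_assoc (p q r : QPath Q) :
    ofPath K p * ofPath K q * ofPath K r = ofPath K p * (ofPath K q * ofPath K r) := by
  have mz : ∀ x : PathAlgebra K Q, x * 0 = 0 := fun x => map_zero (mulₗ x)
  have zm : ∀ x : PathAlgebra K Q, 0 * x = 0 := fun x => by rw [mul_def]; simp
  simp only [ofPath_mul, pathMul]
  by_cases h₁ : p.src = q.tgt <;> by_cases h₂ : q.src = r.tgt
  · rw [dif_pos h₁, dif_pos h₂, ofPath_mul, ofPath_mul, pathMul, pathMul,
      dif_pos (show (p.comp q h₁).src = r.tgt from h₂),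
      dif_pos (show p.src = (q.comp r h₂).tgt from h₁)]
    congr 1
    exact QPath.ext rfl (List.append_assoc _ _ _) rfl
  · rw [dif_pos h₁, dif_neg h₂, ofPath_mul, pathMul,
      dif_neg (show ¬ (p.comp q h₁).src = r.tgt from h₂), mz]
  · rw [dif_neg h₁, dif_pos h₂, ofPath_mul, pathMul,
      dif_neg (show ¬ p.src = (q.comp r h₂).tgt from h₁), zm]
  · rw [dif_neg h₁, dif_neg h₂, mz, zm]

theorem mul_assoc_aux (x y z : PathAlgebra K Q) : x * y * z = x * (y * z) := by
  have h : mulₗ.compr₂ mulₗ =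
      LinearMap.mk₂ K (fun x y : PathAlgebra K Q => mulₗ (K := K) x ∘ₗ mulₗ y)
        (by intros; ext; simp) (by intros; ext; simp)
        (by intros; ext; simp) (by intros; ext; simp) :=
    hom_ext fun p => hom_ext fun q => hom_ext fun r => mul_ofPath_assoc p q r
  exact congrArg (fun f => f x y z) h

theorem triv_mul (i : V) (p : QPath Q) :
    mulₗ (ofPath K (QPath.triv Q i)) (ofPath K p) =
      open Classical in if i = p.tgt then ofPath K p else 0 := by
  rw [← mul_def, ofPath_mul, pathMul]
  by_cases h : i = p.tgt
  · subst h; simp [QPath.triv, QPath.comp]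
  · rw [dif_neg (show ¬ (QPath.triv Q i).src = p.tgt from h), if_neg h]

theorem mul_triv (i : V) (p : QPath Q) :
    mulₗ (ofPath K p) (ofPath K (QPath.triv Q i)) =
      open Classical in if p.src = i then ofPath K p else 0 := by
  rw [← mul_def, ofPath_mul, pathMul]
  by_cases h : p.src = i
  · subst h; simp [QPath.triv, QPath.comp]
  · rw [dif_neg (show ¬ p.src = (QPath.triv Q i).tgt from h), if_neg h]

variable [Fintype V]

/-- The unit is the sum of the trivial paths. -/
instance : One (PathAlgebra K Q) := ⟨∑ i : V, ofPath K (QPath.triv Q i)⟩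

theorem one_def : (1 : PathAlgebra K Q) = ∑ i : V, ofPath K (QPath.triv Q i) := rfl

theorem one_mul_aux (x : PathAlgebra K Q) : 1 * x = x := by
  have h : mulₗ (1 : PathAlgebra K Q) = LinearMap.id := hom_ext fun p => by
    classical simp [one_def, triv_mul, Finset.sum_ite_eq']
  exact congrArg (fun f => f x) h

theorem mul_one_aux (x : PathAlgebra K Q) : x * 1 = x := by
  have h : mulₗ.flip (1 : PathAlgebra K Q) = LinearMap.id := hom_ext fun p => by
    classical simp [one_def, mul_triv, Finset.sum_ite_eq]
  exact congrArg (fun f => f x) h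

instance : Ring (PathAlgebra K Q) where
  mul_assoc := mul_assoc_aux
  one_mul := one_mul_aux
  mul_one := mul_one_aux
  zero_mul x := by rw [mul_def]; simp
  mul_zero x := map_zero (mulₗ x)
  left_distrib x y z := map_add (mulₗ x) y z
  right_distrib x y z := by simp [mul_def]
  zsmul := fun n x => n • x
  zsmul_zero' := fun x => zero_smul ℤ x
  zsmul_succ' := fun n x => SubNegMonoid.zsmul_succ' n x
  zsmul_neg' := fun n x => SubNegMonoid.zsmul_neg' n x
  neg_add_cancel := neg_add_cancel
  sub_eq_add_neg := sub_eq_add_neg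

instance : Algebra K (PathAlgebra K Q) :=
  Algebra.ofModule (fun r x y => by simp [mul_def]) (fun r x y => by simp [mul_def])

end PathAlgebra
end PathAlgebra

/-! ### The graded skew-gentle algebra -/

namespace Triple

variable (K : Type uK) [Field K] {V : Type uV} {E : Type uE} (T : Triple V E)

/-- `S = R ∪ {ε² | ε ∈ Sp}`. -/
def S : Set (QPath T.Q) := T.R ∪ spPowers T.Q T.Sp 2

/-- `Γ_n`: the paths of length `n` all of whose subpaths of length two are in `S`. -/
def Gamma (n : ℕ) : Type (max uV uE) :=
  {q : QPath T.Q // q.length = n ∧ ∀ p : QPath T.Q, p.length = 2 → p.word <:+: q.word → p ∈ T.S}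

namespace Gamma

variable {T} {n : ℕ}

/-- The underlying path. -/
def path (q : T.Gamma n) : QPath T.Q := q.1

theorem word_ne_nil (q : T.Gamma (n + 1)) : q.path.word ≠ [] := by
  intro h
  have := q.2.1
  simp only [QPath.length] at this
  rw [show q.1.word = [] from h] at this
  simp at this

/-- The leftmost arrow `a_n` of `a_n ⋯ a_1`. -/
def leftArrow (q : T.Gamma (n + 1)) : E := q.path.word.head q.word_ne_nil

/-- The rightmost arrow `a_1` of `a_n ⋯ a_1`. -/
def rightArrow (q : T.Gamma (n + 1)) : E := q.path.word.getLast q.word_ne_nil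

/-- The path `a_{n-1} ⋯ a_1` obtained from `a_n ⋯ a_1`. -/
def dropLeft (q : T.Gamma (n + 1)) : T.Gamma n :=
  ⟨q.path.dropLeft, by
    have := q.2.1
    simp only [QPath.length] at this
    simp [QPath.length, QPath.dropLeft_word, path, this], fun p hp h => by
    rw [QPath.dropLeft_word] at h
    exact q.2.2 p hp (h.trans (List.tail_suffix _).isInfix)⟩

/-- The path `a_n ⋯ a_2` obtained from `a_n ⋯ a_1`. -/
def dropRight (q : T.Gamma (n + 1)) : T.Gamma n :=
  ⟨q.path.dropRight, by
    have := q.2.1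
    simp only [QPath.length] at this
    simp [QPath.length, QPath.dropRight_word, path, this], fun p hp h => by
    rw [QPath.dropRight_word] at h
    exact q.2.2 p hp (h.trans (List.dropLast_prefix _).isInfix)⟩

/-- The power `ε^n ∈ Γ_n` of a special loop `ε`. -/
def spPow {ε : E} (hε : ε ∈ T.Sp) (n : ℕ) : T.Gamma n :=
  ⟨QPath.loopPow ε (T.loop ε hε) n, by simp [QPath.length, QPath.loopPow], by
    rintro ⟨j, w, i, hw⟩ hp h
    refine Or.inr ⟨ε, hε, T.loop ε hε, ?_⟩
    have hw2 : w = List.replicate 2 ε := by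
      refine List.eq_replicate_iff.2 ⟨hp, fun b hb => ?_⟩
      exact List.eq_of_mem_replicate (h.subset hb)
    subst hw2
    exact QPath.ext hw.1.symm rfl (hw.2.2.symm)⟩

end Gamma

variable [Fintype V]

/-- The generators `R ∪ {ε² - ε | ε ∈ Sp}` of the ideal `I`. -/
def relators : Set (PathAlgebra K T.Q) :=
  PathAlgebra.ofPath K '' T.R ∪
    {x | ∃ ε ∈ T.Sp, x = PathAlgebra.ofPath K (QPath.arrow T.Q ε) ^ 2 -
      PathAlgebra.ofPath K (QPath.arrow T.Q ε)}

/-- The two-sided ideal `I` of the path algebra. -/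
def ideal : TwoSidedIdeal (PathAlgebra K T.Q) := TwoSidedIdeal.span (T.relators K)

/-- The graded skew-gentle algebra `A = K Q / I`. -/
def Alg : Type (max uK uV uE) := (T.ideal K).ringCon.Quotient

instance : Ring (T.Alg K) := inferInstanceAs (Ring (T.ideal K).ringCon.Quotient)
instance : Algebra K (T.Alg K) := inferInstanceAs (Algebra K (T.ideal K).ringCon.Quotient)

/-- The canonical projection `π : K Q → A`. -/
def proj : PathAlgebra K T.Q →+* T.Alg K := (T.ideal K).ringCon.mk'

/-- The class in `A` of a path. -/
def ofPath (p : QPath T.Q) : T.Alg K := T.proj K (PathAlgebra.ofPath K p)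

/-- The class in `A` of the trivial path at a vertex. -/
def idem (i : V) : T.Alg K := T.ofPath K (QPath.triv T.Q i)

/-- The class in `A` of an arrow. -/
def arr (a : E) : T.Alg K := T.ofPath K (QPath.arrow T.Q a)

/-- The homogeneous component of degree `k` of `A`, spanned by the paths of degree `k`. -/
def algGrading (k : ℤ) : Submodule K (T.Alg K) :=
  Submodule.span K {x | ∃ p : QPath T.Q, p.degree T.deg = k ∧ x = T.ofPath K p}

/-- The enveloping algebra `A ⊗ Aᵒᵖ`; its modules are the `A`-bimodules on which `K` acts
centrally, with `(a ⊗ b) • m = a m b`. -/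
abbrev Env : Type (max uK uV uE) := T.Alg K ⊗[K] (T.Alg K)ᵐᵒᵖ

/-- `a ⊗ b` as an element of the enveloping algebra. -/
def env (a b : T.Alg K) : T.Env K := a ⊗ₜ[K] MulOpposite.op b

/-- `A` as a bimodule over itself, `(a ⊗ b) • x = a x b`. -/
instance : Module (T.Env K) (T.Alg K) := instModuleTensorProductMop K (T.Alg K)

theorem env_smul (a b x : T.Alg K) : T.env K a b • x = a * x * b := by
  change TensorProduct.Algebra.moduleAux _ _ = _
  simp [env, TensorProduct.Algebra.moduleAux, ← mul_assoc]

/-! ### The bimodules `A ⊗ K Γ_n ⊗ A`, tensor products over the span `K Q₀` of the vertices -/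

/-- The free bimodule `A ⊗_K K Γ_n ⊗_K A`, as the direct sum over `γ ∈ Γ_n` of copies of
`A ⊗_K A`. -/
def FreeBimod (n : ℕ) : Type (max uK uV uE) := T.Gamma n →₀ T.Env K

instance (n : ℕ) : AddCommGroup (T.FreeBimod K n) :=
  inferInstanceAs (AddCommGroup (T.Gamma n →₀ T.Env K))
instance (n : ℕ) : Module (T.Env K) (T.FreeBimod K n) :=
  inferInstanceAs (Module (T.Env K) (T.Gamma n →₀ T.Env K))
instance (n : ℕ) : Module K (T.FreeBimod K n) :=
  inferInstanceAs (Module K (T.Gamma n →₀ T.Env K))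
instance (n : ℕ) : IsScalarTower K (T.Env K) (T.FreeBimod K n) :=
  inferInstanceAs (IsScalarTower K (T.Env K) (T.Gamma n →₀ T.Env K))

/-- The pure tensor `a ⊗ γ ⊗ b` over `K`. -/
def freeTensor {n : ℕ} (a : T.Alg K) (γ : T.Gamma n) (b : T.Alg K) : T.FreeBimod K n :=
  Finsupp.single γ (T.env K a b)

open Classical in
/-- The sub-bimodule generated by `a e_i ⊗ γ ⊗ b - a ⊗ e_i γ ⊗ b` and
`a ⊗ γ ⊗ e_i b - a ⊗ γ e_i ⊗ b`, where `e_i γ` is `γ` if `γ` ends at `i` and `0` otherwise,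
and `γ e_i` is `γ` if `γ` starts at `i` and `0` otherwise. -/
def balance (n : ℕ) : Submodule (T.Env K) (T.FreeBimod K n) :=
  Submodule.span (T.Env K)
    ({x | ∃ (a b : T.Alg K) (γ : T.Gamma n) (i : V),
        x = T.freeTensor K (a * T.idem K i) γ b -
          if γ.path.tgt = i then T.freeTensor K a γ b else 0} ∪
      {x | ∃ (a b : T.Alg K) (γ : T.Gamma n) (i : V),
        x = T.freeTensor K a γ (T.idem K i * b) -
          if γ.path.src = i then T.freeTensor K a γ b else 0})

/-- The bimodule `A ⊗ K Γ_n ⊗ A`, with tensor products over `K Q₀`. -/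
def P (n : ℕ) : Type (max uK uV uE) := T.FreeBimod K n ⧸ T.balance K n

instance (n : ℕ) : AddCommGroup (T.P K n) :=
  inferInstanceAs (AddCommGroup (T.FreeBimod K n ⧸ T.balance K n))
instance (n : ℕ) : Module (T.Env K) (T.P K n) :=
  inferInstanceAs (Module (T.Env K) (T.FreeBimod K n ⧸ T.balance K n))
instance (n : ℕ) : Module K (T.P K n) :=
  inferInstanceAs (Module K (T.FreeBimod K n ⧸ T.balance K n))
instance (n : ℕ) : IsScalarTower K (T.Env K) (T.P K n) :=
  inferInstanceAs (IsScalarTower K (T.Env K) (T.FreeBimod K n ⧸ T.balance K n))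

/-- The quotient map from `A ⊗_K K Γ_n ⊗_K A` to `A ⊗ K Γ_n ⊗ A`. -/
def toP (n : ℕ) : T.FreeBimod K n →ₗ[T.Env K] T.P K n := (T.balance K n).mkQ

/-- The element `a ⊗ γ ⊗ b` of `A ⊗ K Γ_n ⊗ A`. -/
def tensor {n : ℕ} (a : T.Alg K) (γ : T.Gamma n) (b : T.Alg K) : T.P K n :=
  T.toP K n (T.freeTensor K a γ b)

/-- The homogeneous component of degree `k` of `A ⊗ K Γ_n ⊗ A`, where `a ⊗ γ ⊗ b` has degree
`|a| + |γ| + |b|`. -/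
def bimodGrading (n : ℕ) (k : ℤ) : Submodule K (T.P K n) :=
  Submodule.span K {x | ∃ (i j : ℤ) (a b : T.Alg K) (γ : T.Gamma n),
    a ∈ T.algGrading K i ∧ b ∈ T.algGrading K j ∧ i + γ.path.degree T.deg + j = k ∧
      x = T.tensor K a γ b}

/-- The defining formulas of the differentials; `d n` is the map `d_{n+1}` from
`A ⊗ K Γ_{n+1} ⊗ A` to `A ⊗ K Γ_n ⊗ A`, and `d₀` is the augmentation. -/
structure IsDifferential (d₀ : T.P K 0 →ₗ[T.Env K] T.Alg K)
    (d : ∀ n : ℕ, T.P K (n + 1) →ₗ[T.Env K] T.P K n) : Prop where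
  augmentation : ∀ q : T.Gamma 0, d₀ (T.tensor K 1 q 1) = T.ofPath K q.path
  nonspecial : ∀ (n : ℕ) (q : T.Gamma (n + 1)), q.path ∉ spPowers T.Q T.Sp (n + 1) →
    d n (T.tensor K 1 q 1) = T.tensor K (T.arr K q.leftArrow) q.dropLeft 1 +
      (-1 : ℤ) ^ (n + 1) • T.tensor K 1 q.dropRight (T.arr K q.rightArrow)
  special_odd : ∀ (n : ℕ) (ε : E) (hε : ε ∈ T.Sp), Odd (n + 1) →
    d n (T.tensor K 1 (Gamma.spPow hε (n + 1)) 1) =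
      T.tensor K (T.arr K ε) (Gamma.spPow hε n) 1 - T.tensor K 1 (Gamma.spPow hε n) (T.arr K ε)
  special_even : ∀ (n : ℕ) (ε : E) (hε : ε ∈ T.Sp), Even (n + 1) →
    d n (T.tensor K 1 (Gamma.spPow hε (n + 1)) 1) =
      T.tensor K (T.arr K ε) (Gamma.spPow hε n) 1 + T.tensor K 1 (Gamma.spPow hε n) (T.arr K ε) -
        T.tensor K 1 (Gamma.spPow hε n) 1

end Triple

/-! ### Graded bimodules and graded projective resolutions -/

section Graded

variable {K : Type*} [Field K] {A : Type*} [Ring A] [Algebra K A]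

/-- The subspaces `𝒜 i`, `i ∈ ℤ`, make `A` a graded algebra. -/
structure IsGradedAlg (𝒜 : ℤ → Submodule K A) : Prop where
  one_mem : (1 : A) ∈ 𝒜 0
  mul_mem : ∀ (i j : ℤ) (a b : A), a ∈ 𝒜 i → b ∈ 𝒜 j → a * b ∈ 𝒜 (i + j)
  internal : DirectSum.IsInternal 𝒜

/-- The subspaces `ℳ j`, `j ∈ ℤ`, make `M` a graded bimodule over the graded algebra `A`. -/
structure IsGradedBimod (𝒜 : ℤ → Submodule K A) {M : Type*} [AddCommGroup M] [Module K M]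
    [Module (A ⊗[K] Aᵐᵒᵖ) M] (ℳ : ℤ → Submodule K M) : Prop where
  smul_mem : ∀ (i j k : ℤ) (a b : A) (m : M), a ∈ 𝒜 i → m ∈ ℳ j → b ∈ 𝒜 k →
    (a ⊗ₜ[K] MulOpposite.op b : A ⊗[K] Aᵐᵒᵖ) • m ∈ ℳ (i + j + k)
  internal : DirectSum.IsInternal ℳ

/-- The map `f` is homogeneous of degree `0`. -/
def PreservesGrading {M N : Type*} [AddCommGroup M] [Module K M] [AddCommGroup N] [Module K N]
    (ℳ : ℤ → Submodule K M) (𝒩 : ℤ → Submodule K N) (f : M → N) : Prop :=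
  ∀ (k : ℤ) (m : M), m ∈ ℳ k → f m ∈ 𝒩 k

/-- `M` is a graded projective bimodule: it is a graded bimodule, it is projective as a bimodule,
and it is projective in the category of graded bimodules and morphisms of degree `0`. -/
structure IsGradedProjective (𝒜 : ℤ → Submodule K A) {M : Type*} [AddCommGroup M] [Module K M]
    [Module (A ⊗[K] Aᵐᵒᵖ) M] (ℳ : ℤ → Submodule K M) : Prop where
  graded : IsGradedBimod 𝒜 ℳ
  projective : Module.Projective (A ⊗[K] Aᵐᵒᵖ) M
  lifting : ∀ (X Y : Type w) [AddCommGroup X] [AddCommGroup Y] [Module K X] [Module K Y]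
    [Module (A ⊗[K] Aᵐᵒᵖ) X] [Module (A ⊗[K] Aᵐᵒᵖ) Y]
    [IsScalarTower K (A ⊗[K] Aᵐᵒᵖ) X] [IsScalarTower K (A ⊗[K] Aᵐᵒᵖ) Y]
    (𝒳 : ℤ → Submodule K X) (𝒴 : ℤ → Submodule K Y),
    IsGradedBimod 𝒜 𝒳 → IsGradedBimod 𝒜 𝒴 →
    ∀ (g : X →ₗ[A ⊗[K] Aᵐᵒᵖ] Y) (f : M →ₗ[A ⊗[K] Aᵐᵒᵖ] Y),
      PreservesGrading 𝒳 𝒴 g → PreservesGrading ℳ 𝒴 f → Function.Surjective g →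
      ∃ h : M →ₗ[A ⊗[K] Aᵐᵒᵖ] X, PreservesGrading ℳ 𝒳 h ∧ g ∘ₗ h = f

/-- The sequence `⋯ → P 1 → P 0 → N → 0` with maps `d n : P (n + 1) → P n` and `d₀ : P 0 → N`
is a graded projective resolution of the graded bimodule `N`. -/
structure IsGradedProjectiveResolution (𝒜 : ℤ → Submodule K A)
    {N : Type*} [AddCommGroup N] [Module K N] [Module (A ⊗[K] Aᵐᵒᵖ) N] (𝒩 : ℤ → Submodule K N)
    {P : ℕ → Type*} [∀ n, AddCommGroup (P n)] [∀ n, Module K (P n)]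
    [∀ n, Module (A ⊗[K] Aᵐᵒᵖ) (P n)] (𝒢 : ∀ n, ℤ → Submodule K (P n))
    (d₀ : P 0 →ₗ[A ⊗[K] Aᵐᵒᵖ] N) (d : ∀ n, P (n + 1) →ₗ[A ⊗[K] Aᵐᵒᵖ] P n) : Prop where
  target_graded : IsGradedBimod 𝒜 𝒩
  gradedProjective : ∀ n, IsGradedProjective.{w} 𝒜 (𝒢 n)
  augmentation_degree : PreservesGrading (𝒢 0) 𝒩 d₀
  differential_degree : ∀ n, PreservesGrading (𝒢 (n + 1)) (𝒢 n) (d n)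
  surjective : Function.Surjective d₀
  exact_zero : Function.Exact (d 0) d₀
  exact_succ : ∀ n, Function.Exact (d (n + 1)) (d n)

end Graded

end

end SkewGentle

/-! The complex is contracted by left `A`-linear maps. Such a map on `A ⊗ KΓ_n ⊗ A` is determined by
its values on `1 ⊗ γ ⊗ u`, with `u` running over a basis of `A`, so a basis of normal paths is
needed first. It comes from an action rather than from a confluence argument: each arrow acts on
`KQ` by an operator `leftOp` that prepends the arrow and applies the rules `ab = 0` for `ab ∈ R` and
`εε = ε` at the left end. These operators satisfy the defining relations on every path, so `A` acts
on `KQ`, and `nf x` is `x` applied to `1`. Every path is zero in `A` or equal to a path fixed by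
`nf` (`ofPath_eq_zero_or_normal`). The rules preserve degrees because special loops have degree `0`,
and this gives the grading of `A`.

By the uniqueness conditions of a gentle pair, an element of `Γ_n` containing a special loop is a
power of it. Hence the differential has one uniform formula `dgen`, with one extra term for even
powers of special loops.

The homotopy `s` is `b ↦ b ⊗ 1` in degree `-1`; in degree `0` it sends `1 ⊗ e ⊗ u` to minus the sum
of `v ⊗ c ⊗ w` over the factorizations `u = vcw` with `c` an arrow; for `γ ∈ Γ_{n+1}` it sends `1 ⊗
γ ⊗ bu'` to `(-1)^n ⊗ γb ⊗ u'` if `γb ∈ Γ_{n+2}`, and `1 ⊗ γ ⊗ u` to `0` if the first letter of `u`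
does not prolong `γ`. There is one exception: a special loop with `ε² ∈ R` is zero in `A`, its
powers form a complex with differentials alternately `0` and `-1`, and `s` is modified accordingly.
The identity `ds + sd = 1` is checked on normal paths in `htpy_zero`, `htpy_one` and `htpy_succ`.

Projectivity, graded or not, holds because `A ⊗ KΓ_n ⊗ A` is cut out of a free bimodule by vertex
idempotents, which have degree `0`. -/

namespace SkewGentle

/-! ### Induction on paths from the left end. -/

section PathLemmas

variable {V : Type uV} {E : Type uE} {Q : Quiv V E}

namespace QPath

/-- The path `a p`. -/
def cons (a : E) (p : QPath Q) (h : Q.src a = p.tgt) : QPath Q :=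
  ⟨Q.tgt a, a :: p.word, p.src, rfl, h ▸ p.isWalk⟩

theorem cons_induction {motive : QPath Q → Prop} (triv : ∀ i, motive (triv Q i))
    (cons : ∀ a p h, motive p → motive (cons a p h)) (p : QPath Q) : motive p := by
  obtain ⟨j, l, i, h⟩ := p
  induction l generalizing j with
  | nil => cases h; exact triv _
  | cons a l ih =>
    obtain ⟨rfl, h'⟩ := h
    exact cons a ⟨_, l, i, h'⟩ rfl (ih _ h')

theorem eq_triv_of_word (p : QPath Q) (h : p.word = []) : p = triv Q p.tgt := by
  obtain ⟨j, l, i, hw⟩ := p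
  cases h
  cases hw
  rfl

theorem eq_cons_of_word {p : QPath Q} {b : E} {l : List E} (h : p.word = b :: l) :
    ∃ (p' : QPath Q) (hb : Q.src b = p'.tgt), p = cons b p' hb := by
  obtain ⟨j, l', i, hw⟩ := p
  cases h
  obtain ⟨rfl, h'⟩ := hw
  exact ⟨⟨_, l, i, h'⟩, rfl, rfl⟩

theorem tgt_eq_of_head? {p : QPath Q} {b : E} (h : p.word.head? = some b) : p.tgt = Q.tgt b := by
  obtain ⟨j, l, i, hw⟩ := p
  cases l with
  | nil => simp at h
  | cons a l =>
    simp only [List.head?_cons, Option.some.injEq] at h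
    subst h
    exact hw.1.symm

end QPath

end PathLemmas

noncomputable section

/-! ### Relations between arrows. -/

namespace Triple

variable (K : Type uK) [Field K] {V : Type uV} {E : Type uE} (T : Triple V E)

/-- The path `ab` exists and lies in `S`. -/
def Rel (a b : E) : Prop := ∃ h : T.Q.src a = T.Q.tgt b, QPath.two a b h ∈ T.S

/-- The path `ab` exists and lies in `R`. -/
def ZeroRel (a b : E) : Prop := ∃ h : T.Q.src a = T.Q.tgt b, QPath.two a b h ∈ T.R

/-- A special loop whose square also lies in `R`; it vanishes in the algebra. -/
def Dead (a : E) : Prop := a ∈ T.Sp ∧ T.ZeroRel a a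

variable {T}

theorem ZeroRel.rel {a b : E} (h : T.ZeroRel a b) : T.Rel a b := ⟨h.1, Or.inl h.2⟩

theorem rel_self {ε : E} (hε : ε ∈ T.Sp) : T.Rel ε ε :=
  ⟨T.loop ε hε, Or.inr ⟨ε, hε, T.loop ε hε, rfl⟩⟩

theorem rel_iff {a b : E} : T.Rel a b ↔ T.ZeroRel a b ∨ (a = b ∧ a ∈ T.Sp) := by
  constructor
  · rintro ⟨h, h' | ⟨ε, hε, h₁, h₂⟩⟩
    · exact Or.inl ⟨h, h'⟩
    · have := congrArg QPath.word h₂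
      simp only [QPath.two, QPath.comp, QPath.arrow, QPath.loopPow, List.replicate,
        List.cons_append, List.nil_append, List.cons.injEq, and_true] at this
      obtain ⟨rfl, rfl⟩ := this
      exact Or.inr ⟨rfl, hε⟩
  · rintro (h | ⟨rfl, h⟩)
    · exact h.rel
    · exact rel_self h

theorem Rel.eq_right {a b c : E} (h : T.Rel a b) (h' : T.Rel a c) : b = c :=
  T.gentle.rel_right a b c h.1 h'.1 h.2 h'.2

theorem Rel.eq_left {a b c : E} (h : T.Rel b a) (h' : T.Rel c a) : b = c :=
  T.gentle.rel_left a b c h.1 h'.1 h.2 h'.2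

/-- A special loop is already related to itself, and gentleness leaves room for only one partner on
each side. -/
theorem Rel.eq_of_left_mem {a b : E} (h : T.Rel a b) (ha : a ∈ T.Sp) : b = a :=
  h.eq_right (rel_self ha)

theorem Rel.eq_of_right_mem {a b : E} (h : T.Rel a b) (hb : b ∈ T.Sp) : a = b :=
  h.eq_left (rel_self hb)

theorem Rel.zeroRel {a b : E} (h : T.Rel a b) (ha : a ∉ T.Sp) : T.ZeroRel a b :=
  (rel_iff.1 h).resolve_right fun h => ha h.2

/-! ### Operators of arrows and paths on normal forms. -/

variable (T)

open Classical in
/-- Left multiplication of an arrow with a path in normal form. -/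
def consNF (a : E) (p : QPath T.Q) : PathAlgebra K T.Q :=
  if h : T.Q.src a = p.tgt then
    -- For a dead loop the relations `aa = 0` and `aa = a` force `a = 0`. The rules are applied only
    -- at the left end, and `p` itself need not be normal.
    if T.Dead a ∨ ∃ b, p.word.head? = some b ∧ T.ZeroRel a b then 0
    else if a ∈ T.Sp ∧ p.word.head? = some a then PathAlgebra.ofPath K p
    else PathAlgebra.ofPath K (QPath.cons a p h)
  else 0

/-- The operator of left multiplication by an arrow on normal forms. -/
def leftOp (a : E) : PathAlgebra K T.Q →ₗ[K] PathAlgebra K T.Q := PathAlgebra.extend (T.consNF K a)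

open Classical in
/-- The projection to the paths ending at a vertex. -/
def vertOp (i : V) : PathAlgebra K T.Q →ₗ[K] PathAlgebra K T.Q :=
  PathAlgebra.extend fun p => if i = p.tgt then PathAlgebra.ofPath K p else 0

/-- The composition of the operators of the letters of a word. -/
def wordOp (l : List E) : PathAlgebra K T.Q →ₗ[K] PathAlgebra K T.Q :=
  l.foldr (fun a f => T.leftOp K a ∘ₗ f) LinearMap.id

/-- The operator of a path on normal forms. -/
def pathOp (p : QPath T.Q) : Module.End K (PathAlgebra K T.Q) :=
  -- The vertex projection is what makes a trivial path, whose word is empty, act correctly; on a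
  -- nonempty word it is redundant by `leftOp_vertOp`.
  T.wordOp K p.word ∘ₗ T.vertOp K p.src

variable {K T}

theorem wordOp_append (l l' : List E) (x : PathAlgebra K T.Q) :
    T.wordOp K (l ++ l') x = T.wordOp K l (T.wordOp K l' x) := by
  induction l with
  | nil => rfl
  | cons a l ih => exact congrArg (T.leftOp K a) ih

theorem leftOp_ofPath (a : E) (p : QPath T.Q) :
    T.leftOp K a (PathAlgebra.ofPath K p) = T.consNF K a p := PathAlgebra.extend_ofPath _ _

theorem vertOp_ofPath (i : V) (p : QPath T.Q) :
    T.vertOp K i (PathAlgebra.ofPath K p) =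
      open Classical in if i = p.tgt then PathAlgebra.ofPath K p else 0 :=
  PathAlgebra.extend_ofPath _ _

theorem leftOp_vertOp (a : E) : T.leftOp K a ∘ₗ T.vertOp K (T.Q.src a) = T.leftOp K a :=
  PathAlgebra.hom_ext fun p => by
    classical
    simp only [LinearMap.comp_apply, vertOp, leftOp, PathAlgebra.extend_ofPath]
    split_ifs with h
    · simp
    · simp [consNF, h]

theorem vertOp_leftOp (a : E) (i : V) :
    T.vertOp K i ∘ₗ T.leftOp K a = open Classical in if i = T.Q.tgt a then T.leftOp K a else 0 :=
  PathAlgebra.hom_ext fun p => by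
    classical
    simp only [LinearMap.comp_apply, leftOp, PathAlgebra.extend_ofPath]
    have key : T.vertOp K i (T.consNF K a p) = if i = T.Q.tgt a then T.consNF K a p else 0 := by
      rw [consNF]
      by_cases h₁ : T.Q.src a = p.tgt
      swap
      · simp [h₁]
      rw [dif_pos h₁]
      by_cases h₂ : T.Dead a ∨ ∃ b, p.word.head? = some b ∧ T.ZeroRel a b
      · simp [h₂]
      rw [if_neg h₂]
      by_cases h₃ : a ∈ T.Sp ∧ p.word.head? = some a
      -- Here `p` is returned unchanged, but its leftmost letter is `a`, so it still ends at the
      -- target of `a`.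
      · rw [if_pos h₃, vertOp_ofPath, QPath.tgt_eq_of_head? h₃.2]
      · rw [if_neg h₃, vertOp_ofPath]
        rfl
    rw [key]
    split_ifs <;> simp

theorem vertOp_vertOp (i j : V) :
    T.vertOp K i ∘ₗ T.vertOp K j = open Classical in if i = j then T.vertOp K j else 0 :=
  PathAlgebra.hom_ext fun p => by
    classical
    rw [LinearMap.comp_apply, vertOp_ofPath]
    by_cases hi : i = j
    · subst hi
      rw [if_pos rfl]
      split_ifs with h
      · rfl
      · rw [vertOp_ofPath, if_neg h, map_zero]
    · rw [if_neg hi]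
      split_ifs with h
      · rw [vertOp_ofPath, if_neg (h ▸ hi)]
        rfl
      · exact map_zero _

theorem vertOp_pathOp (i : V) (p : QPath T.Q) :
    T.vertOp K i ∘ₗ T.pathOp K p = open Classical in if i = p.tgt then T.pathOp K p else 0 := by
  classical
  induction p using QPath.cons_induction with
  | triv j => exact vertOp_vertOp i j
  | cons a p h ih =>
    have : T.pathOp K (QPath.cons a p h) = T.leftOp K a ∘ₗ T.pathOp K p := rfl
    rw [this, ← LinearMap.comp_assoc, vertOp_leftOp]
    change _ = if i = T.Q.tgt a then _ else _
    split_ifs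
    · rfl
    · exact LinearMap.zero_comp _

theorem pathOp_comp (p q : QPath T.Q) (h : p.src = q.tgt) :
    T.pathOp K p * T.pathOp K q = T.pathOp K (p.comp q h) := by
  refine LinearMap.ext fun x => ?_
  have h₁ := LinearMap.congr_fun (vertOp_pathOp (K := K) p.src q) x
  rw [if_pos h] at h₁
  change T.wordOp K p.word ((T.vertOp K p.src ∘ₗ T.pathOp K q) x) = _
  rw [h₁]
  exact (wordOp_append _ _ _).symm

theorem pathOp_mul_of_ne (p q : QPath T.Q) (h : p.src ≠ q.tgt) :
    T.pathOp K p * T.pathOp K q = 0 := by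
  refine LinearMap.ext fun x => ?_
  have h₁ := LinearMap.congr_fun (vertOp_pathOp (K := K) p.src q) x
  rw [if_neg h] at h₁
  change T.wordOp K p.word ((T.vertOp K p.src ∘ₗ T.pathOp K q) x) = _
  rw [h₁]
  exact map_zero _

/-- In each branch a nonzero value of `b` on a path is a path with leftmost letter `b`, and `a`
kills every such path. -/
theorem leftOp_comp_of_zeroRel {a b : E} (h : T.ZeroRel a b) :
    T.leftOp K a ∘ₗ T.leftOp K b = 0 :=
  PathAlgebra.hom_ext fun p => by
    classical
    simp only [LinearMap.comp_apply, leftOp, PathAlgebra.extend_ofPath, LinearMap.zero_apply]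
    rw [consNF]
    split_ifs with h₁ h₂ h₃
    · simp
    · rw [PathAlgebra.extend_ofPath, consNF]
      split_ifs with h₄ h₅ h₆
      · rfl
      · exact absurd (Or.inr ⟨b, h₃.2, h⟩) h₅
      · exact absurd (Or.inr ⟨b, h₃.2, h⟩) h₅
      · rfl
    · rw [PathAlgebra.extend_ofPath, consNF]
      have : (QPath.cons b p h₁).word.head? = some b := rfl
      split_ifs with h₄ h₅ h₆
      · rfl
      · exact absurd (Or.inr ⟨b, this, h⟩) h₅
      · exact absurd (Or.inr ⟨b, this, h⟩) h₅
      · rfl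
    · simp

/-- A nonzero value of `a` is a path beginning with `a`, and `a` fixes such paths: the zero rule
could interfere only if `aa ∈ R`, but then `a` is dead and both sides vanish. -/
theorem leftOp_comp_self {a : E} (h : a ∈ T.Sp) :
    T.leftOp K a ∘ₗ T.leftOp K a = T.leftOp K a :=
  PathAlgebra.hom_ext fun p => by
    classical
    simp only [LinearMap.comp_apply, leftOp, PathAlgebra.extend_ofPath]
    have key : ∀ q : QPath T.Q, ¬ T.Dead a → q.word.head? = some a →
        T.consNF K a q = PathAlgebra.ofPath K q := by
      intro q hd hq
      rw [consNF, dif_pos ((T.loop a h).trans (QPath.tgt_eq_of_head? hq).symm), if_neg, if_pos ⟨h, hq⟩]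
      rintro (h' | ⟨b, hb, hab⟩)
      · exact hd h'
      · rw [hq, Option.some.injEq] at hb
        subst hb
        exact hd ⟨h, hab⟩
    by_cases h₁ : T.Q.src a = p.tgt
    swap
    · simp [consNF, h₁]
    by_cases h₂ : T.Dead a ∨ ∃ b, p.word.head? = some b ∧ T.ZeroRel a b
    · simp [consNF, h₂]
    by_cases h₃ : a ∈ T.Sp ∧ p.word.head? = some a
    · rw [key p (fun h => h₂ (Or.inl h)) h₃.2, PathAlgebra.extend_ofPath,
        key p (fun h => h₂ (Or.inl h)) h₃.2]
    · have : T.consNF K a p = PathAlgebra.ofPath K (QPath.cons a p h₁) := by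
        rw [consNF, dif_pos h₁, if_neg h₂, if_neg h₃]
      rw [this, PathAlgebra.extend_ofPath, key _ (fun h => h₂ (Or.inl h)) rfl]

theorem consNF_of_rel_notMem {a b : E} (h : T.Rel a b) (ha : a ∉ T.Sp) (p : QPath T.Q)
    (hb : T.Q.src b = p.tgt) : T.consNF K a (QPath.cons b p hb) = 0 := by
  classical
  rw [consNF, dif_pos (show T.Q.src a = (QPath.cons b p hb).tgt from h.1),
    if_pos (Or.inr ⟨b, rfl, h.zeroRel ha⟩)]

theorem consNF_of_dead {a : E} (h : T.Dead a) (p : QPath T.Q) : T.consNF K a p = 0 := by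
  classical
  rw [consNF]
  split_ifs with h₁ h₂ h₃
  · rfl
  · exact absurd (Or.inl h) h₂
  · exact absurd (Or.inl h) h₂
  · rfl

theorem consNF_self {a : E} (ha : a ∈ T.Sp) (hd : ¬ T.Dead a) (p : QPath T.Q)
    (hb : T.Q.src a = p.tgt) :
    T.consNF K a (QPath.cons a p hb) = PathAlgebra.ofPath K (QPath.cons a p hb) := by
  classical
  rw [consNF, dif_pos (show T.Q.src a = (QPath.cons a p hb).tgt from T.loop a ha), if_neg,
    if_pos ⟨ha, rfl⟩]
  rintro (h | ⟨c, hc, hac⟩)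
  · exact hd h
  · cases hc
    exact hd ⟨ha, hac⟩

theorem consNF_of_not_rel {a : E} (hd : ¬ T.Dead a) (p : QPath T.Q) (hp : T.Q.src a = p.tgt)
    (h : ¬ ∃ b, p.word.head? = some b ∧ T.Rel a b) :
    T.consNF K a p = PathAlgebra.ofPath K (QPath.cons a p hp) := by
  classical
  rw [consNF, dif_pos hp, if_neg, if_neg]
  · exact fun h' => h ⟨a, h'.2, rel_self h'.1⟩
  · rintro (h' | ⟨b, hb, hab⟩)
    · exact hd h'
    · exact h ⟨b, hb, hab.rel⟩

theorem pathOp_arrow (a : E) : T.pathOp K (QPath.arrow T.Q a) = T.leftOp K a := leftOp_vertOp a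

/-- A path of length two as a product of two arrows. -/
theorem eq_two_of_length {p : QPath T.Q} (hp : p.length = 2) :
    ∃ (a b : E) (h : T.Q.src a = T.Q.tgt b), p = QPath.two a b h := by
  obtain ⟨j, l, i, hw⟩ := p
  obtain ⟨a, b, rfl⟩ := List.length_eq_two.1 hp
  obtain ⟨rfl, h, rfl⟩ := hw
  exact ⟨a, b, h.symm, rfl⟩

/-! ### The action of the algebra and normal paths. -/

variable [Fintype V]

theorem sum_vertOp : ∑ i : V, T.vertOp K i = LinearMap.id :=
  PathAlgebra.hom_ext fun p => by
    classical
    simp [vertOp, LinearMap.sum_apply]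

variable (K T) in
/-- The action of the path algebra on normal forms. -/
def act : PathAlgebra K T.Q →ₐ[K] Module.End K (PathAlgebra K T.Q) :=
  AlgHom.ofLinearMap (PathAlgebra.extend (T.pathOp K))
    (by
      rw [PathAlgebra.one_def, map_sum]
      simp only [PathAlgebra.extend_ofPath]
      exact sum_vertOp)
    (by
      have h : (LinearMap.mul K (PathAlgebra K T.Q)).compr₂ (PathAlgebra.extend (T.pathOp K)) =
          (LinearMap.mul K (Module.End K (PathAlgebra K T.Q))).compl₁₂
            (PathAlgebra.extend (T.pathOp K)) (PathAlgebra.extend (T.pathOp K)) := by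
        refine PathAlgebra.hom_ext fun p => PathAlgebra.hom_ext fun q => ?_
        simp only [LinearMap.compr₂_apply, LinearMap.mul_apply', LinearMap.compl₁₂_apply,
          PathAlgebra.extend_ofPath, PathAlgebra.ofPath_mul, PathAlgebra.pathMul]
        split_ifs with h
        · rw [pathOp_comp p q h, PathAlgebra.extend_ofPath]
        · rw [pathOp_mul_of_ne p q h, map_zero]
      exact fun x y => LinearMap.congr_fun (LinearMap.congr_fun h x) y)

@[simp] theorem act_ofPath (p : QPath T.Q) : T.act K (PathAlgebra.ofPath K p) = T.pathOp K p :=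
  PathAlgebra.extend_ofPath _ _

theorem act_relators {x : PathAlgebra K T.Q} (hx : x ∈ T.relators K) : T.act K x = 0 := by
  rcases hx with ⟨p, hp, rfl⟩ | ⟨ε, hε, rfl⟩
  · obtain ⟨a, b, h, rfl⟩ := eq_two_of_length (T.gentle.length_two p (Or.inl hp))
    have h₁ := pathOp_comp (K := K) (QPath.arrow T.Q a) (QPath.arrow T.Q b) h
    rw [pathOp_arrow, pathOp_arrow] at h₁
    rw [act_ofPath]
    exact h₁.symm.trans (leftOp_comp_of_zeroRel ⟨h, hp⟩)
  · rw [map_sub, map_pow, act_ofPath, pathOp_arrow, sq, sub_eq_zero]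
    exact leftOp_comp_self hε

variable (K T) in
/-- The action of the skew-gentle algebra on normal forms. -/
def algAct : T.Alg K →+* Module.End K (PathAlgebra K T.Q) :=
  (T.ideal K).ringCon.lift (T.act K).toRingHom (by
    have h : T.ideal K ≤ TwoSidedIdeal.ker (T.act K).toRingHom :=
      TwoSidedIdeal.span_le.2 fun x hx =>
        (TwoSidedIdeal.mem_ker _).2 (act_relators hx)
    intro x y hxy
    have := h ((TwoSidedIdeal.rel_iff _ x y).1 hxy)
    rw [TwoSidedIdeal.mem_ker, map_sub, sub_eq_zero] at this
    exact this)

theorem algAct_proj (x : PathAlgebra K T.Q) : T.algAct K (T.proj K x) = T.act K x := rfl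

theorem proj_smul (c : K) (x : PathAlgebra K T.Q) : T.proj K (c • x) = c • T.proj K x := rfl

theorem proj_surjective : Function.Surjective (T.proj K) := RingCon.mk'_surjective _

variable (K T) in
/-- The projection as a linear map. -/
def projₗ : PathAlgebra K T.Q →ₗ[K] T.Alg K where
  toFun := T.proj K
  map_add' := map_add _
  map_smul' := proj_smul

theorem ofPath_mul_ofPath (p q : QPath T.Q) (h : p.src = q.tgt) :
    T.ofPath K p * T.ofPath K q = T.ofPath K (p.comp q h) := by
  rw [ofPath, ofPath, ← map_mul, PathAlgebra.ofPath_mul, PathAlgebra.pathMul, dif_pos h]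
  rfl

theorem ofPath_mul_of_ne (p q : QPath T.Q) (h : p.src ≠ q.tgt) :
    T.ofPath K p * T.ofPath K q = 0 := by
  rw [ofPath, ofPath, ← map_mul, PathAlgebra.ofPath_mul, PathAlgebra.pathMul, dif_neg h, map_zero]

theorem arr_mul_ofPath (a : E) (p : QPath T.Q) (h : T.Q.src a = p.tgt) :
    T.arr K a * T.ofPath K p = T.ofPath K (QPath.cons a p h) :=
  ofPath_mul_ofPath _ _ h

theorem idem_mul_ofPath (i : V) (p : QPath T.Q) :
    T.idem K i * T.ofPath K p = open Classical in if i = p.tgt then T.ofPath K p else 0 := by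
  classical
  split_ifs with h
  · exact ofPath_mul_ofPath (QPath.triv T.Q i) p h |>.trans (by subst h; rfl)
  · exact ofPath_mul_of_ne _ _ h

theorem ofPath_mul_idem (i : V) (p : QPath T.Q) :
    T.ofPath K p * T.idem K i = open Classical in if p.src = i then T.ofPath K p else 0 := by
  classical
  split_ifs with h
  · refine (ofPath_mul_ofPath p (QPath.triv T.Q i) h).trans ?_
    subst h
    exact congrArg _ (QPath.ext rfl (List.append_nil _) rfl)
  · exact ofPath_mul_of_ne _ _ h

theorem arr_mul_idem (a : E) : T.arr K a * T.idem K (T.Q.src a) = T.arr K a :=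
  (ofPath_mul_idem _ _).trans (if_pos rfl)

theorem idem_mul_arr (a : E) : T.idem K (T.Q.tgt a) * T.arr K a = T.arr K a :=
  (idem_mul_ofPath _ _).trans (if_pos rfl)

theorem idem_mul_self (i : V) : T.idem K i * T.idem K i = T.idem K i :=
  (idem_mul_ofPath _ _).trans (if_pos rfl)

theorem idem_mul_of_ne {i j : V} (h : i ≠ j) : T.idem K i * T.idem K j = 0 :=
  ofPath_mul_of_ne _ _ h

theorem sum_idem : ∑ i : V, T.idem K i = 1 := by
  rw [← map_one (T.proj K), PathAlgebra.one_def, map_sum]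
  rfl

theorem proj_eq_zero {x : PathAlgebra K T.Q} (h : x ∈ T.relators K) : T.proj K x = 0 := by
  have h₁ : x ∈ T.ideal K := TwoSidedIdeal.subset_span h
  exact (RingCon.eq _).2 ((TwoSidedIdeal.mem_iff _ x).1 h₁)

theorem arr_mul_arr_of_zeroRel {a b : E} (h : T.ZeroRel a b) : T.arr K a * T.arr K b = 0 := by
  rw [arr, arr, ofPath_mul_ofPath _ _ h.1]
  exact proj_eq_zero (Or.inl ⟨_, h.2, rfl⟩)

theorem arr_mul_self {ε : E} (h : ε ∈ T.Sp) : T.arr K ε * T.arr K ε = T.arr K ε := by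
  have := proj_eq_zero (K := K) (T := T) (Or.inr ⟨ε, h, rfl⟩)
  rw [map_sub, map_pow, sub_eq_zero, sq] at this
  exact this

theorem arr_eq_zero_of_dead {ε : E} (h : T.Dead ε) : T.arr K ε = 0 := by
  rw [← arr_mul_self h.1, arr_mul_arr_of_zeroRel h.2]

variable (K T) in
/-- The normal form of an element of the skew-gentle algebra. -/
def nf : T.Alg K →ₗ[K] PathAlgebra K T.Q where
  toFun x := T.algAct K x 1
  map_add' x y := by rw [map_add]; rfl
  map_smul' c x := by
    obtain ⟨x, rfl⟩ := proj_surjective x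
    rw [← proj_smul, algAct_proj, algAct_proj, map_smul]
    rfl

theorem nf_ofPath_mul (p : QPath T.Q) (x : T.Alg K) :
    T.nf K (T.ofPath K p * x) = T.pathOp K p (T.nf K x) := by
  change T.algAct K (T.ofPath K p * x) 1 = T.pathOp K p (T.algAct K x 1)
  rw [map_mul, Module.End.mul_apply, ofPath, algAct_proj, act_ofPath]

theorem nf_arr_mul (a : E) (x : T.Alg K) : T.nf K (T.arr K a * x) = T.leftOp K a (T.nf K x) := by
  rw [arr, nf_ofPath_mul, pathOp_arrow]

theorem nf_idem_mul (i : V) (x : T.Alg K) : T.nf K (T.idem K i * x) = T.vertOp K i (T.nf K x) :=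
  nf_ofPath_mul _ _

theorem nf_one : T.nf K 1 = 1 := by
  change T.algAct K 1 1 = 1
  rw [(T.algAct K).map_one]
  rfl

theorem nf_idem (i : V) : T.nf K (T.idem K i) = PathAlgebra.ofPath K (QPath.triv T.Q i) := by
  classical
  rw [← mul_one (T.idem K i), nf_idem_mul, nf_one, PathAlgebra.one_def, map_sum]
  simp [vertOp, QPath.triv]

variable (K T) in
/-- A path is normal if it is its own normal form. -/
def IsNormal (p : QPath T.Q) : Prop := T.nf K (T.ofPath K p) = PathAlgebra.ofPath K p

/-- Every rewriting made by `consNF` is an identity in `A`; this links the operators to the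
multiplication. -/
theorem consNF_cases (a : E) (p : QPath T.Q) (h : T.Q.src a = p.tgt) :
    (T.consNF K a p = 0 ∧ T.arr K a * T.ofPath K p = 0) ∨
    (T.consNF K a p = PathAlgebra.ofPath K p ∧ a ∈ T.Sp ∧
      T.arr K a * T.ofPath K p = T.ofPath K p) ∨
    (T.consNF K a p = PathAlgebra.ofPath K (QPath.cons a p h)) := by
  classical
  rw [consNF, dif_pos h]
  split_ifs with h₁ h₂
  · refine Or.inl ⟨rfl, ?_⟩
    rcases h₁ with h₁ | ⟨b, hb, hab⟩
    · rw [arr_eq_zero_of_dead h₁, zero_mul]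
    · obtain ⟨l, hl⟩ := List.head?_eq_some_iff.1 hb
      obtain ⟨p', hb, rfl⟩ := QPath.eq_cons_of_word hl
      rw [← arr_mul_ofPath, ← mul_assoc, arr_mul_arr_of_zeroRel hab, zero_mul]
  · refine Or.inr (Or.inl ⟨rfl, h₂.1, ?_⟩)
    obtain ⟨l, hl⟩ := List.head?_eq_some_iff.1 h₂.2
    obtain ⟨p', hb, rfl⟩ := QPath.eq_cons_of_word hl
    rw [← arr_mul_ofPath, ← mul_assoc, arr_mul_self h₂.1]
  · exact Or.inr (Or.inr rfl)

/-- Every path is zero or equal to a normal path of the same degree in the algebra. -/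
theorem ofPath_eq_zero_or_normal (p : QPath T.Q) :
    T.ofPath K p = 0 ∨ ∃ u : QPath T.Q, T.IsNormal K u ∧ u.degree T.deg = p.degree T.deg ∧
      u.tgt = p.tgt ∧ T.ofPath K p = T.ofPath K u := by
  induction p using QPath.cons_induction with
  | triv i => exact Or.inr ⟨_, nf_idem i, rfl, rfl, rfl⟩
  | cons a p h ih =>
    rw [← arr_mul_ofPath]
    rcases ih with ih | ⟨u, hu, hd, ht, hpu⟩
    · exact Or.inl (by rw [ih, mul_zero])
    rw [hpu]
    have hau : T.Q.src a = u.tgt := h.trans ht.symm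
    have hdeg : ∀ (q : QPath T.Q) (h' : T.Q.src a = q.tgt),
        (QPath.cons a q h').degree T.deg = T.deg a + q.degree T.deg := fun q h' => by
      simp [QPath.cons, QPath.degree]
    rcases consNF_cases (K := K) a u hau with h₁ | h₁ | h₁
    · exact Or.inl h₁.2
    · refine Or.inr ⟨u, hu, ?_, ?_, h₁.2.2⟩
      -- Absorbing a repeated special loop keeps the degree because the loop has degree `0`.
      · rw [hdeg, T.deg_special a h₁.2.1, zero_add, hd]
      · rw [← hau, T.loop a h₁.2.1]; rfl
    · refine Or.inr ⟨QPath.cons a u hau, ?_, ?_, rfl, arr_mul_ofPath _ _ _⟩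
      · rw [IsNormal, ← arr_mul_ofPath, nf_arr_mul, hu, leftOp, PathAlgebra.extend_ofPath, h₁]
      · rw [hdeg, hdeg, hd]

theorem ofPath_span : Submodule.span K (Set.range (T.ofPath K)) = ⊤ := by
  rw [eq_top_iff]
  rintro x -
  obtain ⟨x, rfl⟩ := proj_surjective x
  change T.projₗ K x ∈ _
  induction x using Finsupp.induction_linear with
  | zero => exact (map_zero (T.projₗ K)).symm ▸ Submodule.zero_mem _
  | add f g hf hg => exact (map_add (T.projₗ K) f g).symm ▸ Submodule.add_mem _ hf hg
  | single p c =>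
    have : (Finsupp.single p c : PathAlgebra K T.Q) = c • PathAlgebra.ofPath K p :=
      (Finsupp.smul_single_one p c).symm
    rw [this, map_smul]
    exact Submodule.smul_mem _ _ (Submodule.subset_span ⟨p, rfl⟩)

/-- Linear maps on the algebra agree if they agree on normal paths. -/
theorem hom_ext_normal {M : Type*} [AddCommGroup M] [Module K M] {f g : T.Alg K →ₗ[K] M}
    (h : ∀ p, T.IsNormal K p → f (T.ofPath K p) = g (T.ofPath K p)) : f = g := by
  refine LinearMap.ext_on_range ofPath_span fun p => ?_
  rcases ofPath_eq_zero_or_normal (K := K) p with hp | ⟨u, hu, -, -, hp⟩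
  · rw [hp, map_zero, map_zero]
  · rw [hp, h u hu]

end Triple

end

end SkewGentle

namespace SkewGentle

noncomputable section

namespace Triple

variable {K : Type uK} [Field K] {V : Type uV} {E : Type uE} {T : Triple V E} [Fintype V] {n : ℕ}

/-! ### The bimodules -/

theorem env_mul_env (a b c d : T.Alg K) : T.env K a b * T.env K c d = T.env K (a * c) (d * b) := by
  rw [env, env, Algebra.TensorProduct.tmul_mul_tmul, ← MulOpposite.op_mul]
  rfl

theorem env_one : T.env K 1 1 = 1 := rfl

theorem env_add_left (a a' b : T.Alg K) : T.env K (a + a') b = T.env K a b + T.env K a' b :=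
  TensorProduct.add_tmul _ _ _

theorem env_add_right (a b b' : T.Alg K) : T.env K a (b + b') = T.env K a b + T.env K a b' :=
  TensorProduct.tmul_add _ _ _

theorem env_smul_left (c : K) (a b : T.Alg K) : T.env K (c • a) b = c • T.env K a b := rfl

theorem env_smul_right (c : K) (a b : T.Alg K) : T.env K a (c • b) = c • T.env K a b :=
  TensorProduct.tmul_smul c a (MulOpposite.op b)

theorem env_zero_left (b : T.Alg K) : T.env K 0 b = 0 := TensorProduct.zero_tmul _ _

theorem env_zero_right (a : T.Alg K) : T.env K a 0 = 0 := TensorProduct.tmul_zero _ _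

instance : IsScalarTower K (T.Env K) (T.Alg K) where
  smul_assoc c z x := by
    induction z using TensorProduct.induction_on with
    | zero =>
      exact (congrArg (· • x) (smul_zero c)).trans
        ((zero_smul (T.Env K) x).trans ((congrArg (c • ·) (zero_smul (T.Env K) x)).trans
          (smul_zero c)).symm)
    | tmul a b =>
      have h₁ := T.env_smul K a b.unop x
      have h₂ := T.env_smul K (c • a) b.unop x
      rw [smul_mul_assoc, smul_mul_assoc, ← h₁] at h₂
      exact h₂
    | add y z hy hz => rw [smul_add, add_smul, add_smul, hy, hz, smul_add]

variable (K) in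
/-- The pure tensors as a bilinear map. -/
def tensorₗ (γ : T.Gamma n) : T.Alg K →ₗ[K] T.Alg K →ₗ[K] T.P K n :=
  LinearMap.mk₂ K (fun a b => T.tensor K a γ b)
    (fun a a' b => by
      simp only [tensor, freeTensor, env_add_left]
      exact congrArg _ (Finsupp.single_add _ _ _))
    (fun c a b => by
      simp only [tensor, freeTensor, env_smul_left]
      exact congrArg _ (Finsupp.smul_single _ _ _).symm)
    (fun a b b' => by
      simp only [tensor, freeTensor, env_add_right]
      exact congrArg _ (Finsupp.single_add _ _ _))
    (fun c a b => by
      simp only [tensor, freeTensor, env_smul_right]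
      exact congrArg _ (Finsupp.smul_single _ _ _).symm)

theorem tensorₗ_apply (γ : T.Gamma n) (a b : T.Alg K) : tensorₗ K γ a b = T.tensor K a γ b := rfl

@[simp] theorem tensor_zero_right (γ : T.Gamma n) (a : T.Alg K) : T.tensor K a γ 0 = 0 :=
  map_zero (tensorₗ K γ a)

@[simp] theorem tensor_zero_left (γ : T.Gamma n) (a : T.Alg K) : T.tensor K 0 γ a = 0 :=
  LinearMap.map_zero₂ (tensorₗ K γ) a

theorem env_smul_freeTensor (γ : T.Gamma n) (a b c d : T.Alg K) :
    T.env K a b • T.freeTensor K c γ d = T.freeTensor K (a * c) γ (d * b) := by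
  rw [freeTensor, freeTensor, ← env_mul_env]
  exact Finsupp.smul_single (T.env K a b) γ (T.env K c d)

@[simp] theorem env_smul_tensor (γ : T.Gamma n) (a b c d : T.Alg K) :
    T.env K a b • T.tensor K c γ d = T.tensor K (a * c) γ (d * b) := by
  rw [tensor, tensor, ← map_smul, env_smul_freeTensor]

theorem tensor_mul_idem (γ : T.Gamma n) (a b : T.Alg K) (i : V) :
    T.tensor K (a * T.idem K i) γ b =
      open Classical in if γ.path.tgt = i then T.tensor K a γ b else 0 := by
  classical
  have h : T.toP K n (T.freeTensor K (a * T.idem K i) γ b -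
      if γ.path.tgt = i then T.freeTensor K a γ b else 0) = 0 :=
    (Submodule.Quotient.mk_eq_zero _).2 (Submodule.subset_span (Or.inl ⟨a, b, γ, i, by congr⟩))
  rw [map_sub, sub_eq_zero] at h
  rw [tensor, h]
  split_ifs
  · rfl
  · exact map_zero _

theorem tensor_idem_mul (γ : T.Gamma n) (a b : T.Alg K) (i : V) :
    T.tensor K a γ (T.idem K i * b) =
      open Classical in if γ.path.src = i then T.tensor K a γ b else 0 := by
  classical
  have h : T.toP K n (T.freeTensor K a γ (T.idem K i * b) -
      if γ.path.src = i then T.freeTensor K a γ b else 0) = 0 :=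
    (Submodule.Quotient.mk_eq_zero _).2 (Submodule.subset_span (Or.inr ⟨a, b, γ, i, by congr⟩))
  rw [map_sub, sub_eq_zero] at h
  rw [tensor, h]
  split_ifs
  · rfl
  · exact map_zero _

theorem tensor_idem_tgt (γ : T.Gamma n) (b : T.Alg K) :
    T.tensor K (T.idem K γ.path.tgt) γ b = T.tensor K 1 γ b := by
  rw [← one_mul (T.idem K γ.path.tgt), tensor_mul_idem, if_pos rfl]

theorem tensor_idem_src (γ : T.Gamma n) (a : T.Alg K) :
    T.tensor K a γ (T.idem K γ.path.src) = T.tensor K a γ 1 := by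
  rw [← mul_one (T.idem K γ.path.src), tensor_idem_mul, if_pos rfl]

theorem tensor_ofPath_of_ne (γ : T.Gamma n) (a : T.Alg K) (p : QPath T.Q)
    (h : γ.path.src ≠ p.tgt) : T.tensor K a γ (T.ofPath K p) = 0 := by
  have h₁ := idem_mul_ofPath (K := K) p.tgt p
  rw [if_pos rfl] at h₁
  rw [← h₁, tensor_idem_mul, if_neg h]

theorem tensor_eq_env_smul (γ : T.Gamma n) (a b : T.Alg K) :
    T.tensor K a γ b = T.env K a b • T.tensor K 1 γ 1 := by simp

theorem toP_surjective : Function.Surjective (T.toP K n) := Submodule.mkQ_surjective _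

theorem free_induction {motive : T.FreeBimod K n → Prop} (zero : motive 0)
    (tensor : ∀ a γ b, motive (T.freeTensor K a γ b))
    (add : ∀ x y, motive x → motive y → motive (x + y)) (x : T.FreeBimod K n) : motive x := by
  induction x using Finsupp.induction_linear with
  | zero => exact zero
  | add f g hf hg => exact add f g hf hg
  | single γ z =>
    induction z using TensorProduct.induction_on with
    | zero => rw [Finsupp.single_zero]; exact zero
    | tmul a b => exact tensor a γ b.unop
    | add y z hy hz => rw [Finsupp.single_add]; exact add _ _ hy hz

theorem P_induction {motive : T.P K n → Prop} (zero : motive 0)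
    (tensor : ∀ a γ b, motive (T.tensor K a γ b))
    (add : ∀ x y, motive x → motive y → motive (x + y)) (x : T.P K n) : motive x := by
  obtain ⟨x, rfl⟩ := toP_surjective x
  induction x using free_induction with
  | zero => rw [map_zero]; exact zero
  | tensor a γ b => exact tensor a γ b
  | add x y hx hy => rw [map_add]; exact add _ _ hx hy

theorem P_addHom_ext {M : Type*} [AddCommGroup M] {f g : T.P K n →+ M}
    (h : ∀ a γ b, f (T.tensor K a γ b) = g (T.tensor K a γ b)) : f = g := by
  ext x
  induction x using P_induction with
  | zero => rw [map_zero, map_zero]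
  | tensor a γ b => exact h a γ b
  | add x y hx hy => rw [map_add, map_add, hx, hy]

section liftK

variable {M : Type*} [AddCommGroup M] [Module K M]

/-- The linear map on `A ⊗_K K Γ_n ⊗_K A` given by bilinear maps. -/
def freeLift (f : T.Gamma n → T.Alg K →ₗ[K] T.Alg K →ₗ[K] M) : T.FreeBimod K n →ₗ[K] M :=
  Finsupp.lsum K fun γ =>
    TensorProduct.lift ((f γ).compl₂ (MulOpposite.opLinearEquiv K).symm.toLinearMap)

theorem freeLift_freeTensor (f : T.Gamma n → T.Alg K →ₗ[K] T.Alg K →ₗ[K] M) (a : T.Alg K)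
    (γ : T.Gamma n) (b : T.Alg K) : freeLift f (T.freeTensor K a γ b) = f γ a b := by
  refine (Finsupp.lsum_single _ _ _ _).trans ?_
  exact TensorProduct.lift.tmul _ _

/-- A family of bilinear maps is balanced over the span of the vertices. -/
structure IsBalanced (f : T.Gamma n → T.Alg K →ₗ[K] T.Alg K →ₗ[K] M) : Prop where
  left : ∀ γ a b i, f γ (a * T.idem K i) b =
    open Classical in if γ.path.tgt = i then f γ a b else 0
  right : ∀ γ a b i, f γ a (T.idem K i * b) =
    open Classical in if γ.path.src = i then f γ a b else 0

variable {f : T.Gamma n → T.Alg K →ₗ[K] T.Alg K →ₗ[K] M}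

theorem IsBalanced.freeLift_balance (hf : IsBalanced f) {x : T.FreeBimod K n}
    (hx : x ∈ T.balance K n) : freeLift f x = 0 := by
  classical
  -- `freeLift f` is only `K`-linear while `balance` is a span over the enveloping algebra, so the
  -- induction has to carry all multiples of `x`.
  suffices h : ∀ z : T.Env K, freeLift f (z • x) = 0 by simpa using h 1
  have hz : ∀ x : T.FreeBimod K n, (∀ c d, freeLift f (T.env K c d • x) = 0) →
      ∀ z : T.Env K, freeLift f (z • x) = 0 := by
    intro x h z
    induction z using TensorProduct.induction_on with
    | zero => exact (congrArg _ (zero_smul (T.Env K) x)).trans (map_zero _)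
    | tmul a b => exact h a b.unop
    | add y z hy hz => rw [add_smul, map_add, hy, hz, add_zero]
  induction hx using Submodule.span_induction with
  | mem x hx =>
    refine hz x fun c d => ?_
    rcases hx with ⟨a, b, γ, i, rfl⟩ | ⟨a, b, γ, i, rfl⟩
    · rw [smul_sub, map_sub, smul_ite, smul_zero, apply_ite (freeLift f), map_zero,
        env_smul_freeTensor, env_smul_freeTensor, freeLift_freeTensor, freeLift_freeTensor,
        ← mul_assoc, hf.left, sub_eq_zero]
    · rw [smul_sub, map_sub, smul_ite, smul_zero, apply_ite (freeLift f), map_zero,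
        env_smul_freeTensor, env_smul_freeTensor, freeLift_freeTensor, freeLift_freeTensor,
        mul_assoc, hf.right, sub_eq_zero]
  | zero => intro z; rw [smul_zero, map_zero]
  | add x y _ _ hx hy => intro z; rw [smul_add, map_add, hx, hy, add_zero]
  | smul w x _ hx => intro z; rw [smul_smul]; exact hx _

/-- The linear map on `A ⊗ K Γ_n ⊗ A` given by a balanced family of bilinear maps. -/
def IsBalanced.lift (hf : IsBalanced f) : T.P K n →ₗ[K] M where
  -- The submodule is over the enveloping algebra and the map is only `K`-linear, so the descent is
  -- made for additive groups and `K`-linearity is checked afterwards.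
  toFun := QuotientAddGroup.lift (T.balance K n).toAddSubgroup (freeLift f).toAddMonoidHom
    fun _ hx => hf.freeLift_balance hx
  map_add' := map_add _
  map_smul' c x := by
    obtain ⟨x, rfl⟩ := toP_surjective x
    exact (freeLift f).map_smul c x

@[simp] theorem IsBalanced.lift_tensor (hf : IsBalanced f) (a : T.Alg K) (γ : T.Gamma n)
    (b : T.Alg K) : hf.lift (T.tensor K a γ b) = f γ a b :=
  freeLift_freeTensor f a γ b

end liftK

section desc

variable {M : Type*} [AddCommGroup M] [Module (T.Env K) M]

variable (K) in
/-- Elements `m γ` of a bimodule with `e_{t(γ)} (m γ) e_{s(γ)} = m γ`. -/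
def IsCompatible (m : T.Gamma n → M) : Prop :=
  ∀ γ, T.env K (T.idem K γ.path.tgt) (T.idem K γ.path.src) • m γ = m γ

/-- The bimodule map on `A ⊗_K K Γ_n ⊗_K A` with prescribed values on the generators. -/
def freeDesc (m : T.Gamma n → M) : T.FreeBimod K n →ₗ[T.Env K] M :=
  -- The coefficient semiring is `ℕ` because the enveloping algebra need not be commutative.
  Finsupp.lsum ℕ fun γ => LinearMap.toSpanSingleton (T.Env K) M (m γ)

theorem freeDesc_freeTensor (m : T.Gamma n → M) (a : T.Alg K) (γ : T.Gamma n) (b : T.Alg K) :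
    freeDesc m (T.freeTensor K a γ b) = T.env K a b • m γ :=
  Finsupp.lsum_single ℕ _ _ _

/-- The bimodule map with prescribed values on the generators. -/
def IsCompatible.desc {m : T.Gamma n → M} (hm : IsCompatible K m) : T.P K n →ₗ[T.Env K] M :=
  (T.balance K n).liftQ (freeDesc m) (by
    have hl : ∀ a b γ i, T.env K (a * T.idem K i) b • m γ =
        open Classical in if γ.path.tgt = i then T.env K a b • m γ else 0 := by
      intro a b γ i
      -- Compatibility puts `e_{t(γ)}` next to `e_i`, and the product of these two idempotents is
      -- `e_i` or `0`.
      rw [← hm γ, smul_smul, env_mul_env, smul_smul, env_mul_env, mul_assoc]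
      split_ifs with h
      · rw [h, idem_mul_self]
      · rw [idem_mul_of_ne (Ne.symm h), mul_zero, env_zero_left]
        exact zero_smul (T.Env K) (m γ)
    have hr : ∀ a b γ i, T.env K a (T.idem K i * b) • m γ =
        open Classical in if γ.path.src = i then T.env K a b • m γ else 0 := by
      intro a b γ i
      rw [← hm γ, smul_smul, env_mul_env, smul_smul, env_mul_env, ← mul_assoc]
      split_ifs with h
      · rw [h, idem_mul_self]
      · rw [idem_mul_of_ne h, zero_mul, env_zero_right]
        exact zero_smul (T.Env K) (m γ)
    rw [balance, Submodule.span_le]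
    rintro x (⟨a, b, γ, i, rfl⟩ | ⟨a, b, γ, i, rfl⟩)
    · rw [SetLike.mem_coe, LinearMap.mem_ker, map_sub, freeDesc_freeTensor, hl, sub_eq_zero]
      split_ifs
      · exact (freeDesc_freeTensor _ _ _ _).symm
      · exact (map_zero _).symm
    · rw [SetLike.mem_coe, LinearMap.mem_ker, map_sub, freeDesc_freeTensor, hr, sub_eq_zero]
      split_ifs
      · exact (freeDesc_freeTensor _ _ _ _).symm
      · exact (map_zero _).symm)

theorem IsCompatible.desc_tensor {m : T.Gamma n → M} (hm : IsCompatible K m) (a : T.Alg K)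
    (γ : T.Gamma n) (b : T.Alg K) : hm.desc (T.tensor K a γ b) = T.env K a b • m γ :=
  Finsupp.lsum_single ℕ _ _ _

theorem P_hom_ext {f g : T.P K n →ₗ[T.Env K] M}
    (h : ∀ γ, f (T.tensor K 1 γ 1) = g (T.tensor K 1 γ 1)) : f = g := by
  have : f.toAddMonoidHom = g.toAddMonoidHom := P_addHom_ext fun a γ b => by
    rw [tensor_eq_env_smul]
    exact (f.map_smul _ _).trans ((congrArg _ (h γ)).trans (g.map_smul _ _).symm)
  exact LinearMap.ext fun x => DFunLike.congr_fun this x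

end desc

theorem isCompatible_freeTensor : IsCompatible K fun γ : T.Gamma n =>
    T.freeTensor K (T.idem K γ.path.tgt) γ (T.idem K γ.path.src) := fun γ => by
  rw [env_smul_freeTensor, idem_mul_self, idem_mul_self]

/-- The assignment `γ ↦ e_{t(γ)} ⊗ γ ⊗ e_{s(γ)}` splits the projection from the free bimodule. -/
instance P_projective : Module.Projective (T.Env K) (T.P K n) := by
  have : Module.Projective (T.Env K) (T.FreeBimod K n) :=
    inferInstanceAs (Module.Projective (T.Env K) (T.Gamma n →₀ T.Env K))
  refine Module.Projective.of_split (isCompatible_freeTensor (K := K) (T := T) (n := n)).desc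
    (T.toP K n) (P_hom_ext fun γ => ?_)
  rw [LinearMap.comp_apply, IsCompatible.desc_tensor, map_smul]
  change _ • T.tensor K _ γ _ = _
  rw [env_smul_tensor, one_mul, mul_one, tensor_idem_tgt, tensor_idem_src]
  rfl

end Triple

/-! ### Gradings -/

section

variable {K : Type*} [Field K] {M : Type*} [AddCommGroup M] [Module K M]

/-- The `k`-th coordinate of `δ` is the identity on `ℳ k` and zero on the other pieces, which forces
independence. -/
theorem isInternal_of_coaction {ℳ : ℤ → Submodule K M} (hspan : ⨆ k, ℳ k = ⊤)
    (δ : M →ₗ[K] ℤ →₀ M) (hδ : ∀ k, ∀ m ∈ ℳ k, δ m = Finsupp.single k m) :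
    DirectSum.IsInternal ℳ := by
  rw [DirectSum.isInternal_submodule_iff_iSupIndep_and_iSup_eq_top]
  refine ⟨?_, hspan⟩
  rw [iSupIndep_def]
  intro k
  rw [Submodule.disjoint_def]
  intro x hx hx'
  have h : ⨆ j, ⨆ (_ : j ≠ k), ℳ j ≤ LinearMap.ker (Finsupp.lapply k ∘ₗ δ) := by
    refine iSup₂_le fun j hj m hm => ?_
    rw [LinearMap.mem_ker, LinearMap.comp_apply, hδ j m hm, Finsupp.lapply_apply,
      Finsupp.single_eq_of_ne hj.symm]
  have h₁ := h hx'
  rw [LinearMap.mem_ker, LinearMap.comp_apply, hδ k x hx, Finsupp.lapply_apply,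
    Finsupp.single_eq_same] at h₁
  exact h₁

/-- Take any preimage and keep its component of degree `k`: a homogeneous map commutes with taking
components. -/
theorem exists_homogeneous_lift {N : Type*} [AddCommGroup N] [Module K N]
    {ℳ : ℤ → Submodule K M} {𝒩 : ℤ → Submodule K N} (hM : DirectSum.IsInternal ℳ)
    (hN : DirectSum.IsInternal 𝒩) (g : M →ₗ[K] N) (hg : PreservesGrading ℳ 𝒩 g)
    (hs : Function.Surjective g) {k : ℤ} {y : N} (hy : y ∈ 𝒩 k) : ∃ x ∈ ℳ k, g x = y := by
  classical
  obtain ⟨x, rfl⟩ := hs y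
  obtain ⟨x, rfl⟩ := hM.2 x
  refine ⟨x k, (x k).2, ?_⟩
  let φ : (DirectSum ℤ fun i => ℳ i) →+ DirectSum ℤ fun i => 𝒩 i :=
    DirectSum.map fun i => (g.toAddMonoidHom.comp (ℳ i).subtype.toAddMonoidHom).codRestrict
      (𝒩 i).toAddSubmonoid fun m => hg i m m.2
  have hφ : ∀ z : DirectSum ℤ fun i => ℳ i, DirectSum.coeAddMonoidHom 𝒩 (φ z) =
      g (DirectSum.coeAddMonoidHom ℳ z) := by
    intro z
    induction z using DirectSum.induction_on with
    | zero => simp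
    | of i m => simp only [φ, DirectSum.map_of, DirectSum.coeAddMonoidHom_of]; rfl
    | add a b ha hb => rw [map_add, map_add, ha, hb, map_add, map_add]
  rw [← hφ x] at hy ⊢
  have h : φ x = DirectSum.of (fun i => 𝒩 i) k ⟨_, hy⟩ := by
    apply hN.1
    rw [DirectSum.coeAddMonoidHom_of]
  have h₁ : (φ x k : N) = g (x k) := rfl
  rw [← h₁, h, DirectSum.of_eq_same]
  rw [DirectSum.coeAddMonoidHom_of]

end

/-! ### The gradings of the algebra and of the bimodules, and graded projectivity. -/

namespace Triple

variable {K : Type uK} [Field K] {V : Type uV} {E : Type uE} {T : Triple V E} [Fintype V] {n : ℕ}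

theorem ofPath_mem_algGrading (p : QPath T.Q) : T.ofPath K p ∈ T.algGrading K (p.degree T.deg) :=
  Submodule.subset_span ⟨p, rfl, rfl⟩

theorem idem_mem_algGrading (i : V) : T.idem K i ∈ T.algGrading K 0 :=
  ofPath_mem_algGrading (QPath.triv T.Q i)

theorem arr_mem_algGrading (a : E) : T.arr K a ∈ T.algGrading K (T.deg a) := by
  have := ofPath_mem_algGrading (K := K) (QPath.arrow T.Q a)
  rwa [show (QPath.arrow T.Q a).degree T.deg = T.deg a by simp [QPath.degree, QPath.arrow]] at this

theorem one_mem_algGrading : (1 : T.Alg K) ∈ T.algGrading K 0 := by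
  rw [← sum_idem]
  exact Submodule.sum_mem _ fun i _ => idem_mem_algGrading i

theorem mul_mem_algGrading {i j : ℤ} {a b : T.Alg K} (ha : a ∈ T.algGrading K i)
    (hb : b ∈ T.algGrading K j) : a * b ∈ T.algGrading K (i + j) := by
  induction ha using Submodule.span_induction with
  | zero => rw [zero_mul]; exact Submodule.zero_mem _
  | add x y _ _ hx hy => rw [add_mul]; exact Submodule.add_mem _ hx hy
  | smul c x _ hx => rw [smul_mul_assoc]; exact Submodule.smul_mem _ _ hx
  | mem x hx =>
    obtain ⟨p, rfl, rfl⟩ := hx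
    induction hb using Submodule.span_induction with
    | zero => rw [mul_zero]; exact Submodule.zero_mem _
    | add x y _ _ hx hy => rw [mul_add]; exact Submodule.add_mem _ hx hy
    | smul c x _ hx => rw [mul_smul_comm]; exact Submodule.smul_mem _ _ hx
    | mem x hx =>
      obtain ⟨q, rfl, rfl⟩ := hx
      by_cases h : p.src = q.tgt
      · rw [ofPath_mul_ofPath p q h]
        convert ofPath_mem_algGrading (K := K) (p.comp q h) using 2
        simp [QPath.degree, QPath.comp]
      · rw [ofPath_mul_of_ne p q h]
        exact Submodule.zero_mem _

variable (K T) in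
/-- The map sending a homogeneous element `x` of degree `k` to `x` placed in degree `k`. -/
def algCoaction : T.Alg K →ₗ[K] ℤ →₀ T.Alg K :=
  PathAlgebra.extend (fun p => Finsupp.single (p.degree T.deg) (T.ofPath K p)) ∘ₗ T.nf K

/-- The degree of a nonzero class of a path is well defined, since the normal path representing it
has the same degree. -/
theorem algCoaction_ofPath (p : QPath T.Q) :
    T.algCoaction K (T.ofPath K p) = Finsupp.single (p.degree T.deg) (T.ofPath K p) := by
  rcases ofPath_eq_zero_or_normal (K := K) p with hp | ⟨u, hu, hd, -, hp⟩
  · rw [hp, map_zero, Finsupp.single_zero]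
  · rw [hp, algCoaction, LinearMap.comp_apply, hu, PathAlgebra.extend_ofPath, hd]

theorem algCoaction_of_mem {k : ℤ} {x : T.Alg K} (hx : x ∈ T.algGrading K k) :
    T.algCoaction K x = Finsupp.single k x := by
  induction hx using Submodule.span_induction with
  | zero => rw [map_zero, Finsupp.single_zero]
  | add x y _ _ hx hy => rw [map_add, hx, hy, Finsupp.single_add]
  | smul c x _ hx => rw [map_smul, hx, Finsupp.smul_single]
  | mem x hx =>
    obtain ⟨p, rfl, rfl⟩ := hx
    exact algCoaction_ofPath p

theorem iSup_algGrading : ⨆ k, T.algGrading K k = ⊤ := by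
  rw [eq_top_iff, ← ofPath_span, Submodule.span_le]
  rintro _ ⟨p, rfl⟩
  exact Submodule.mem_iSup_of_mem _ (ofPath_mem_algGrading p)

variable (K T) in
theorem isGradedAlg_algGrading : IsGradedAlg (T.algGrading K) where
  one_mem := one_mem_algGrading
  mul_mem _ _ _ _ := mul_mem_algGrading
  internal := isInternal_of_coaction iSup_algGrading (T.algCoaction K) fun _ _ => algCoaction_of_mem

variable (K T) in
theorem isGradedBimod_algGrading : IsGradedBimod (T.algGrading K) (T.algGrading K) where
  smul_mem i j k a b m ha hm hb := by
    have : (a ⊗ₜ[K] MulOpposite.op b : T.Env K) • m = a * m * b := T.env_smul K a b m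
    rw [this]
    exact mul_mem_algGrading (mul_mem_algGrading ha hm) hb
  internal := (isGradedAlg_algGrading K T).internal

theorem tensor_mem_bimodGrading {i j k : ℤ} {a b : T.Alg K} (γ : T.Gamma n)
    (ha : a ∈ T.algGrading K i) (hb : b ∈ T.algGrading K j)
    (h : i + γ.path.degree T.deg + j = k) : T.tensor K a γ b ∈ T.bimodGrading K n k :=
  Submodule.subset_span ⟨i, j, a, b, γ, ha, hb, h, rfl⟩

/-- Two linear maps agree on the algebra if they agree on homogeneous elements. -/
theorem hom_ext_homogeneous {M : Type*} [AddCommGroup M] [Module K M] {f g : T.Alg K →ₗ[K] M}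
    (h : ∀ k, ∀ x ∈ T.algGrading K k, f x = g x) : f = g :=
  LinearMap.ext_on_range ofPath_span fun p => h _ _ (ofPath_mem_algGrading p)

/-- Two bilinear maps agree on the algebra if they agree on homogeneous elements. -/
theorem bilin_ext_homogeneous {M : Type*} [AddCommGroup M] [Module K M]
    {f g : T.Alg K →ₗ[K] T.Alg K →ₗ[K] M}
    (h : ∀ k l, ∀ x ∈ T.algGrading K k, ∀ y ∈ T.algGrading K l, f x y = g x y) : f = g :=
  hom_ext_homogeneous fun k x hx => hom_ext_homogeneous fun l y hy => h k l x hx y hy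

/-- The bilinear maps defining the coaction on `A ⊗ K Γ_n ⊗ A`. -/
def bimodCoactionAux (γ : T.Gamma n) : T.Alg K →ₗ[K] T.Alg K →ₗ[K] ℤ →₀ T.P K n :=
  LinearMap.compl₁₂
    -- Both factors are split into components, and `a_i ⊗ γ ⊗ b_j` is placed in degree `i + |γ| +
    -- j`.
    (Finsupp.lsum K fun i => LinearMap.flip (Finsupp.lsum K fun j => LinearMap.flip
      ((tensorₗ K γ).compr₂ (Finsupp.lsingle (i + γ.path.degree T.deg + j)))))
    (T.algCoaction K) (T.algCoaction K)

theorem bimodCoactionAux_apply (γ : T.Gamma n) {i j : ℤ} {a b : T.Alg K}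
    (ha : a ∈ T.algGrading K i) (hb : b ∈ T.algGrading K j) :
    bimodCoactionAux γ a b =
      Finsupp.single (i + γ.path.degree T.deg + j) (T.tensor K a γ b) := by
  rw [bimodCoactionAux, LinearMap.compl₁₂_apply, algCoaction_of_mem ha, algCoaction_of_mem hb,
    Finsupp.lsum_single, LinearMap.flip_apply, Finsupp.lsum_single]
  rfl

/-- Multiplication by a vertex idempotent does not shift degrees, so the balancing relations hold
degree by degree. -/
theorem isBalanced_bimodCoactionAux :
    IsBalanced (bimodCoactionAux (K := K) (T := T) (n := n)) := by
  classical
  constructor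
  · intro γ a b i
    have h : bimodCoactionAux γ ∘ₗ LinearMap.mulRight K (T.idem K i) =
        if γ.path.tgt = i then bimodCoactionAux γ else 0 := by
      refine bilin_ext_homogeneous fun k l x hx y hy => ?_
      have hx' := mul_mem_algGrading hx (idem_mem_algGrading i)
      rw [LinearMap.comp_apply, LinearMap.mulRight_apply, bimodCoactionAux_apply γ hx' hy,
        tensor_mul_idem, add_zero]
      split_ifs
      · rw [bimodCoactionAux_apply γ hx hy]
      · rw [Finsupp.single_zero]; rfl
    have h₁ := LinearMap.congr_fun (LinearMap.congr_fun h a) b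
    refine h₁.trans ?_
    split_ifs <;> rfl
  · intro γ a b i
    have h : (bimodCoactionAux γ).compl₂ (LinearMap.mulLeft K (T.idem K i)) =
        if γ.path.src = i then bimodCoactionAux γ else 0 := by
      refine bilin_ext_homogeneous fun k l x hx y hy => ?_
      have hy' := mul_mem_algGrading (idem_mem_algGrading i) hy
      rw [LinearMap.compl₂_apply, LinearMap.mulLeft_apply, bimodCoactionAux_apply γ hx hy',
        tensor_idem_mul, zero_add]
      split_ifs
      · rw [bimodCoactionAux_apply γ hx hy]
      · rw [Finsupp.single_zero]; rfl
    have h₁ := LinearMap.congr_fun (LinearMap.congr_fun h a) b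
    refine h₁.trans ?_
    split_ifs <;> rfl

theorem iSup_bimodGrading : ⨆ k, T.bimodGrading K n k = ⊤ := by
  rw [eq_top_iff]
  rintro x -
  induction x using P_induction with
  | zero => exact Submodule.zero_mem _
  | add x y hx hy => exact Submodule.add_mem _ hx hy
  | tensor a γ b =>
    have ha : a ∈ Submodule.span K (Set.range (T.ofPath K)) := by
      rw [ofPath_span]; exact Submodule.mem_top
    have hb : b ∈ Submodule.span K (Set.range (T.ofPath K)) := by
      rw [ofPath_span]; exact Submodule.mem_top
    have h := Submodule.apply_mem_map₂ (tensorₗ K γ) ha hb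
    rw [Submodule.map₂_span_span] at h
    refine Submodule.span_le.2 ?_ h
    rintro _ ⟨_, ⟨p, rfl⟩, _, ⟨q, rfl⟩, rfl⟩
    exact Submodule.mem_iSup_of_mem _ (tensor_mem_bimodGrading γ (ofPath_mem_algGrading p)
      (ofPath_mem_algGrading q) rfl)

variable (K T n) in
theorem isGradedBimod_bimodGrading : IsGradedBimod (T.algGrading K) (T.bimodGrading K n) where
  smul_mem i j k a b m ha hm hb := by
    change T.env K a b • m ∈ _
    induction hm using Submodule.span_induction with
    | zero => rw [smul_zero]; exact Submodule.zero_mem _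
    | add x y _ _ hx hy => rw [smul_add]; exact Submodule.add_mem _ hx hy
    | smul c x _ hx => rw [smul_algebra_smul_comm]; exact Submodule.smul_mem _ _ hx
    | mem x hx =>
      obtain ⟨i', j', a', b', γ, ha', hb', h, rfl⟩ := hx
      rw [env_smul_tensor]
      exact tensor_mem_bimodGrading γ (mul_mem_algGrading ha ha') (mul_mem_algGrading hb' hb)
        (by linarith)
  internal := by
    refine isInternal_of_coaction iSup_bimodGrading
      (isBalanced_bimodCoactionAux (K := K) (T := T) (n := n)).lift fun k m hm => ?_
    induction hm using Submodule.span_induction with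
    | zero => rw [map_zero, Finsupp.single_zero]
    | add x y _ _ hx hy => rw [map_add, hx, hy, Finsupp.single_add]
    | smul c x _ hx => rw [map_smul, hx, Finsupp.smul_single]
    | mem x hx =>
      obtain ⟨i, j, a, b, γ, ha, hb, rfl, rfl⟩ := hx
      rw [IsBalanced.lift_tensor, bimodCoactionAux_apply γ ha hb]

theorem generator_mem_bimodGrading (γ : T.Gamma n) :
    T.tensor K 1 γ 1 ∈ T.bimodGrading K n (γ.path.degree T.deg) :=
  tensor_mem_bimodGrading γ one_mem_algGrading one_mem_algGrading (by ring)

/-- A bimodule map is homogeneous if it is so on the generators. -/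
theorem preservesGrading_of_generators {M : Type*} [AddCommGroup M] [Module K M]
    [Module (T.Env K) M] [IsScalarTower K (T.Env K) M] {ℳ : ℤ → Submodule K M}
    (hM : IsGradedBimod (T.algGrading K) ℳ) (f : T.P K n →ₗ[T.Env K] M)
    (hf : ∀ γ : T.Gamma n, f (T.tensor K 1 γ 1) ∈ ℳ (γ.path.degree T.deg)) :
    PreservesGrading (T.bimodGrading K n) ℳ f := by
  intro k m hm
  induction hm using Submodule.span_induction with
  | zero => rw [map_zero]; exact Submodule.zero_mem _
  | add x y _ _ hx hy => rw [map_add]; exact Submodule.add_mem _ hx hy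
  | smul c x _ hx => rw [LinearMap.map_smul_of_tower]; exact Submodule.smul_mem _ _ hx
  | mem x hx =>
    obtain ⟨i, j, a, b, γ, ha, hb, rfl, rfl⟩ := hx
    rw [tensor_eq_env_smul, map_smul]
    exact hM.smul_mem i _ j a b _ ha (hf γ) hb

variable (K T n) in
theorem isGradedProjective_bimodGrading :
    IsGradedProjective.{w} (T.algGrading K) (T.bimodGrading K n) where
  graded := isGradedBimod_bimodGrading K T n
  projective := P_projective
  lifting X Y _ _ _ _ _ _ _ _ 𝒳 𝒴 hX hY g f hg hf hs := by
    have h₁ : ∀ γ : T.Gamma n, ∃ x ∈ 𝒳 (γ.path.degree T.deg), g x = f (T.tensor K 1 γ 1) :=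
      fun γ => exists_homogeneous_lift hX.internal hY.internal (g.restrictScalars K) hg hs
        (hf _ _ (generator_mem_bimodGrading γ))
    choose x hx hgx using h₁
    -- The chosen preimage `x γ` need not be supported at the end points of `γ`. Cutting it down by
    -- idempotents changes neither its degree nor its image, since the generator is fixed by the
    -- same idempotents.
    have hm : IsCompatible K fun γ : T.Gamma n =>
        T.env K (T.idem K γ.path.tgt) (T.idem K γ.path.src) • x γ := fun γ => by
      rw [smul_smul, env_mul_env, idem_mul_self, idem_mul_self]
    refine ⟨hm.desc, preservesGrading_of_generators hX _ fun γ => ?_, P_hom_ext fun γ => ?_⟩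
    · rw [hm.desc_tensor, env_one, one_smul]
      have := hX.smul_mem 0 _ 0 _ _ _ (idem_mem_algGrading (K := K) γ.path.tgt) (hx γ)
        (idem_mem_algGrading γ.path.src)
      rwa [zero_add, add_zero] at this
    · rw [LinearMap.comp_apply, hm.desc_tensor, env_one, one_smul, map_smul, hgx, ← map_smul,
        env_smul_tensor, mul_one, one_mul, tensor_idem_tgt, tensor_idem_src]

end Triple

end

end SkewGentle

/-! ### Combinatorics of the paths in `Γ_n`. -/

namespace SkewGentle

section

variable {V : Type uV} {E : Type uE} {Q : Quiv V E}

theorem Quiv.IsWalk.src_eq_of_append {u v : List E} {a b : E} {j i : V}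
    (h : Q.IsWalk j (u ++ a :: b :: v) i) : Q.src a = Q.tgt b := by
  induction u generalizing j with
  | nil => exact h.2.1.symm
  | cons c u ih => exact ih h.2

theorem Quiv.IsWalk.tgt_eq_head {l : List E} {j i : V} (h : Q.IsWalk j l i) (hl : l ≠ []) :
    j = Q.tgt (l.head hl) := by
  cases l with
  | nil => exact absurd rfl hl
  | cons a l => exact h.1.symm

theorem Quiv.IsWalk.src_eq_getLast {l : List E} {j i : V} (h : Q.IsWalk j l i) (hl : l ≠ []) :
    i = Q.src (l.getLast hl) := by
  induction l generalizing j with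
  | nil => exact absurd rfl hl
  | cons a l ih =>
    cases l with
    | nil => exact h.2.symm
    | cons b l =>
      rw [List.getLast_cons (by simp)]
      exact ih h.2 (by simp)

theorem QPath.ext_word {p q : QPath Q} (hp : p.word ≠ []) (h : p.word = q.word) : p = q := by
  obtain ⟨j, l, i, hw⟩ := p
  obtain ⟨j', l', i', hw'⟩ := q
  cases h
  cases (hw.tgt_eq_head hp).trans (hw'.tgt_eq_head hp).symm
  cases (hw.src_eq_getLast hp).trans (hw'.src_eq_getLast hp).symm
  rfl

theorem QPath.dropLeft_cons (a : E) (p : QPath Q) (h : Q.src a = p.tgt) :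
    (cons a p h).dropLeft = p :=
  QPath.ext h rfl rfl

end

namespace Triple

variable {V : Type uV} {E : Type uE} {T : Triple V E} {n : ℕ}

namespace Gamma

/-- The condition on subpaths becomes one on consecutive letters, the form suited to induction and
to prolonging paths. -/
theorem isChain_word (q : T.Gamma n) : q.path.word.IsChain T.Rel := by
  have h : ∀ u l : List E, q.path.word = u ++ l → l.IsChain T.Rel := by
    intro u l
    induction l generalizing u with
    | nil => intro _; exact List.isChain_nil
    | cons a l ih =>
      intro h
      cases l with
      | nil => exact List.isChain_singleton a
      | cons b l =>
        refine List.isChain_cons_cons.2 ⟨?_, ih (u ++ [a]) (by simpa using h)⟩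
        have hw := q.path.isWalk
        rw [h] at hw
        refine ⟨hw.src_eq_of_append, q.2.2 _ rfl ⟨u, l, ?_⟩⟩
        exact Eq.trans (by simp [QPath.two, QPath.comp, QPath.arrow]) h.symm
  exact h [] _ rfl

theorem mem_of_isChain {p : QPath T.Q} (hp : p.word.IsChain T.Rel) (q : QPath T.Q)
    (hq : q.length = 2) (h : q.word <:+: p.word) : q ∈ T.S := by
  obtain ⟨a, b, hab, rfl⟩ := eq_two_of_length hq
  exact (List.isChain_cons_cons.1 (hp.infix h)).1.2

theorem ext_word {q q' : T.Gamma (n + 1)} (h : q.path.word = q'.path.word) : q = q' :=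
  Subtype.ext (QPath.ext_word q.word_ne_nil h)

theorem path_tgt (q : T.Gamma (n + 1)) : q.path.tgt = T.Q.tgt q.leftArrow :=
  q.path.isWalk.tgt_eq_head _

theorem path_src (q : T.Gamma (n + 1)) : q.path.src = T.Q.src q.rightArrow :=
  q.path.isWalk.src_eq_getLast _

theorem dropLeft_word (q : T.Gamma (n + 1)) : q.dropLeft.path.word = q.path.word.tail :=
  QPath.dropLeft_word _

theorem dropRight_word (q : T.Gamma (n + 1)) : q.dropRight.path.word = q.path.word.dropLast :=
  QPath.dropRight_word _

theorem word_eq_cons (q : T.Gamma (n + 1)) :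
    q.path.word = q.leftArrow :: q.dropLeft.path.word := by
  rw [dropLeft_word, leftArrow, List.cons_head_tail]

theorem word_eq_concat (q : T.Gamma (n + 1)) :
    q.path.word = q.dropRight.path.word ++ [q.rightArrow] := by
  rw [dropRight_word, rightArrow, List.dropLast_append_getLast]

theorem dropLeft_src (q : T.Gamma (n + 1)) : q.dropLeft.path.src = q.path.src := by
  obtain ⟨⟨j, _ | ⟨a, l⟩, i, hw⟩, h⟩ := q <;> rfl

theorem dropRight_tgt (q : T.Gamma (n + 1)) : q.dropRight.path.tgt = q.path.tgt := by
  obtain ⟨⟨j, _ | ⟨a, l⟩, i, hw⟩, h⟩ := q <;> rfl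

theorem dropLeft_tgt (q : T.Gamma (n + 1)) : q.dropLeft.path.tgt = T.Q.src q.leftArrow := by
  obtain ⟨⟨j, _ | ⟨a, l⟩, i, hw⟩, h⟩ := q
  · simp [QPath.length] at h
  · rfl

theorem dropRight_src (q : T.Gamma (n + 1)) : q.dropRight.path.src = T.Q.tgt q.rightArrow := by
  obtain ⟨⟨j, _ | ⟨a, l⟩, i, hw⟩, h⟩ := q
  · simp [QPath.length] at h
  · rfl

theorem leftArrow_eq {q : T.Gamma (n + 1)} {a : E} {l : List E} (h : q.path.word = a :: l) :
    q.leftArrow = a := by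
  rw [word_eq_cons] at h
  exact (List.cons.inj h).1

theorem rightArrow_eq {q : T.Gamma (n + 1)} {a : E} {l : List E} (h : q.path.word = l ++ [a]) :
    q.rightArrow = a := by
  rw [word_eq_concat] at h
  exact (List.append_singleton_inj.1 h).2

theorem length_word (q : T.Gamma n) : q.path.word.length = n := q.2.1

theorem rightArrow_dropLeft (q : T.Gamma (n + 2)) : q.dropLeft.rightArrow = q.rightArrow := by
  symm
  apply rightArrow_eq (l := q.leftArrow :: q.dropLeft.dropRight.path.word)
  rw [List.cons_append, ← word_eq_concat, ← word_eq_cons]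

theorem leftArrow_dropRight (q : T.Gamma (n + 2)) : q.dropRight.leftArrow = q.leftArrow := by
  symm
  apply leftArrow_eq (l := q.dropRight.dropLeft.path.word ++ [q.rightArrow])
  rw [← List.cons_append, ← word_eq_cons, ← word_eq_concat]

theorem dropLeft_dropRight (q : T.Gamma (n + 2)) : q.dropLeft.dropRight = q.dropRight.dropLeft := by
  refine Subtype.ext (QPath.ext ?_ ?_ ?_)
  · change q.dropLeft.dropRight.path.tgt = q.dropRight.dropLeft.path.tgt
    rw [dropRight_tgt, dropLeft_tgt, dropLeft_tgt, leftArrow_dropRight]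
  · change q.dropLeft.dropRight.path.word = q.dropRight.dropLeft.path.word
    rw [dropRight_word, dropLeft_word, dropLeft_word, dropRight_word, List.tail_dropLast]
  · change q.dropLeft.dropRight.path.src = q.dropRight.dropLeft.path.src
    rw [dropRight_src, dropLeft_src, dropRight_src, rightArrow_dropLeft]

theorem rel_left (q : T.Gamma (n + 2)) : T.Rel q.leftArrow q.dropLeft.leftArrow := by
  have h := q.isChain_word
  rw [word_eq_cons, word_eq_cons q.dropLeft] at h
  exact (List.isChain_cons_cons.1 h).1

theorem rel_right (q : T.Gamma (n + 2)) : T.Rel q.dropRight.rightArrow q.rightArrow := by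
  have h := q.isChain_word
  rw [word_eq_concat, word_eq_concat q.dropRight, List.append_assoc] at h
  exact (List.isChain_cons_cons.1 (List.isChain_append.1 h).2.1).1

/-- The path `γ b`, where `b` satisfies a relation with the rightmost arrow of `γ`. -/
def snoc (γ : T.Gamma (n + 1)) (b : E) (h : T.Rel γ.rightArrow b) : T.Gamma (n + 2) :=
  ⟨γ.path.comp (QPath.arrow T.Q b) (γ.path_src.trans h.1),
    by
      have := γ.length_word
      simp [QPath.length, QPath.comp, QPath.arrow, this],
    mem_of_isChain (by
      refine List.isChain_append.2 ⟨γ.isChain_word, List.isChain_singleton b, ?_⟩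
      intro x hx y hy
      rw [word_eq_concat, List.getLast?_concat, Option.mem_some_iff] at hx
      rw [QPath.arrow, List.head?_cons, Option.mem_some_iff] at hy
      rw [← hx, ← hy]
      exact h)⟩

section snoc

variable (γ : T.Gamma (n + 1)) (b : E) (h : T.Rel γ.rightArrow b)

theorem snoc_word : (γ.snoc b h).path.word = γ.path.word ++ [b] := rfl

theorem rightArrow_snoc : (γ.snoc b h).rightArrow = b := rightArrow_eq (γ.snoc_word b h)

theorem leftArrow_snoc : (γ.snoc b h).leftArrow = γ.leftArrow :=
  leftArrow_eq (l := γ.dropLeft.path.word ++ [b]) (by rw [snoc_word, word_eq_cons]; rfl)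

theorem dropRight_snoc : (γ.snoc b h).dropRight = γ :=
  ext_word (by rw [dropRight_word, snoc_word, List.dropLast_concat])

theorem path_tgt_snoc : (γ.snoc b h).path.tgt = γ.path.tgt := rfl

end snoc

theorem dropLeft_snoc (γ : T.Gamma (n + 2)) (b : E) (h : T.Rel γ.rightArrow b) :
    (γ.snoc b h).dropLeft = γ.dropLeft.snoc b (γ.rightArrow_dropLeft.symm ▸ h) :=
  ext_word (by
    rw [dropLeft_word, snoc_word, snoc_word, dropLeft_word, List.tail_append_of_ne_nil γ.word_ne_nil])

theorem snoc_dropRight (γ : T.Gamma (n + 2)) : γ.dropRight.snoc γ.rightArrow γ.rel_right = γ :=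
  ext_word (by rw [snoc_word, ← word_eq_concat])

/-- The only related neighbour of a special loop, on either side, is the loop itself, so one
occurrence spreads over the whole word. -/
theorem eq_replicate_of_mem {l : List E} (hl : l.IsChain T.Rel) {ε : E} (hε : ε ∈ T.Sp)
    (h : ε ∈ l) : ∀ a ∈ l, a = ε := by
  induction l with
  | nil => simp
  | cons b l ih =>
    cases l with
    | nil => simp_all
    | cons c l =>
      have hbc := (List.isChain_cons_cons.1 hl).1
      have ih := ih (List.isChain_cons_cons.1 hl).2
      have hmem : ε ∈ c :: l := by
        rcases List.mem_cons.1 h with rfl | h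
        · rw [hbc.eq_of_left_mem hε]; exact List.mem_cons_self
        · exact h
      have ih := ih hmem
      have hc : c = ε := ih c List.mem_cons_self
      intro a ha
      rcases List.mem_cons.1 ha with rfl | ha
      · subst hc
        exact hbc.eq_of_right_mem hε
      · exact ih a ha

theorem eq_spPow_of_mem (q : T.Gamma (n + 1)) {ε : E} (hε : ε ∈ T.Sp) (h : ε ∈ q.path.word) :
    q = spPow hε (n + 1) :=
  ext_word (List.eq_replicate_iff.2 ⟨q.length_word, eq_replicate_of_mem q.isChain_word hε h⟩)

theorem rightArrow_mem (q : T.Gamma (n + 1)) : q.rightArrow ∈ q.path.word := List.getLast_mem _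

theorem leftArrow_mem (q : T.Gamma (n + 1)) : q.leftArrow ∈ q.path.word := List.head_mem _

section spPow

variable {ε : E} (hε : ε ∈ T.Sp)

theorem spPow_word : (spPow hε n).path.word = List.replicate n ε := rfl

theorem leftArrow_spPow : (spPow hε (n + 1)).leftArrow = ε := leftArrow_eq rfl

theorem rightArrow_spPow : (spPow hε (n + 1)).rightArrow = ε :=
  rightArrow_eq (l := List.replicate n ε) (by rw [spPow_word, List.replicate_succ'])

theorem dropLeft_spPow : (spPow hε (n + 1)).dropLeft = spPow hε n :=
  Subtype.ext (QPath.ext (T.loop ε hε) rfl rfl)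

theorem dropRight_spPow : (spPow hε (n + 1)).dropRight = spPow hε n := by
  refine Subtype.ext (QPath.ext rfl ?_ ?_)
  · change (spPow hε (n + 1)).dropRight.path.word = _
    rw [dropRight_word, spPow_word, List.dropLast_replicate]
    rfl
  · change (spPow hε (n + 1)).dropRight.path.src = _
    rw [dropRight_src, rightArrow_spPow]
    exact (T.loop ε hε).symm

end spPow

/-- Consequently the rightmost arrow alone decides which formula of the differential applies. -/
theorem eq_spPow_of_rightArrow (q : T.Gamma (n + 1)) (h : q.rightArrow ∈ T.Sp) :
    q = spPow h (n + 1) := q.eq_spPow_of_mem h q.rightArrow_mem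

theorem leftArrow_eq_rightArrow (q : T.Gamma (n + 1)) (h : q.rightArrow ∈ T.Sp) :
    q.leftArrow = q.rightArrow := by
  have := congrArg leftArrow (q.eq_spPow_of_rightArrow h)
  rwa [leftArrow_spPow] at this

theorem dropLeft_eq_dropRight (q : T.Gamma (n + 1)) (h : q.rightArrow ∈ T.Sp) :
    q.dropLeft = q.dropRight := by
  have h₁ := q.eq_spPow_of_rightArrow h
  have h₂ := congrArg dropLeft h₁
  have h₃ := congrArg dropRight h₁
  rw [dropLeft_spPow] at h₂
  rw [dropRight_spPow] at h₃
  rw [h₂, h₃]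

theorem dropLeft_snoc_self (q : T.Gamma (n + 1)) (h : q.rightArrow ∈ T.Sp) :
    (q.snoc q.rightArrow (rel_self h)).dropLeft = q := by
  rw [dropLeft_eq_dropRight, dropRight_snoc]
  rw [rightArrow_snoc]
  exact h

theorem notMem_rightArrow (q : T.Gamma (n + 1)) (h : q.path ∉ spPowers T.Q T.Sp (n + 1)) :
    q.rightArrow ∉ T.Sp := fun hε =>
  h ⟨q.rightArrow, hε, T.loop _ hε, congrArg path (q.eq_spPow_of_rightArrow hε)⟩

theorem mem_rightArrow (q : T.Gamma (n + 1)) (h : q.path ∈ spPowers T.Q T.Sp (n + 1)) :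
    q.rightArrow ∈ T.Sp := by
  obtain ⟨ε, hε, hl, hq⟩ := h
  have : q.rightArrow = ε := rightArrow_eq (l := List.replicate n ε) (by
    rw [hq, ← List.replicate_succ']
    rfl)
  rw [this]
  exact hε

theorem leftArrow_notMem (q : T.Gamma (n + 1)) (h : q.rightArrow ∉ T.Sp) : q.leftArrow ∉ T.Sp :=
  fun hl => h (by
    have := congrArg rightArrow (q.eq_spPow_of_mem hl q.leftArrow_mem)
    rw [this, rightArrow_spPow]
    exact hl)

theorem rightArrow_dropRight_notMem (q : T.Gamma (n + 2)) (h : q.rightArrow ∉ T.Sp) :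
    q.dropRight.rightArrow ∉ T.Sp := fun h' => h (by
  rw [q.rel_right.eq_of_left_mem h']
  exact h')

/-- An arrow as an element of `Γ_1`. -/
def ofArrow (T : Triple V E) (a : E) : T.Gamma 1 :=
  ⟨QPath.arrow T.Q a, rfl, mem_of_isChain (List.isChain_singleton a)⟩

/-- A vertex as an element of `Γ_0`. -/
def ofVertex (T : Triple V E) (i : V) : T.Gamma 0 :=
  ⟨QPath.triv T.Q i, rfl, mem_of_isChain List.isChain_nil⟩

theorem eq_ofVertex (q : T.Gamma 0) : q = ofVertex T q.path.tgt :=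
  Subtype.ext (q.path.eq_triv_of_word (List.length_eq_zero_iff.1 q.length_word))

theorem eq_ofArrow (q : T.Gamma 1) : q = ofArrow T q.rightArrow :=
  ext_word (by
    rw [word_eq_concat, List.length_eq_zero_iff.1 q.dropRight.length_word]
    rfl)

theorem leftArrow_one (γ : T.Gamma 1) : γ.leftArrow = γ.rightArrow := by
  rw [γ.eq_ofArrow]
  rfl

theorem dropLeft_snoc_one (γ : T.Gamma 1) (b : E) (h : T.Rel γ.rightArrow b) :
    (γ.snoc b h).dropLeft = ofArrow T b :=
  (eq_ofArrow _).trans (by rw [rightArrow_dropLeft, rightArrow_snoc])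

end Gamma

theorem degree_eq_left (q : T.Gamma (n + 1)) :
    q.path.degree T.deg = T.deg q.leftArrow + q.dropLeft.path.degree T.deg := by
  rw [QPath.degree, q.word_eq_cons, List.map_cons, List.sum_cons, QPath.degree]

theorem degree_eq_right (q : T.Gamma (n + 1)) :
    q.path.degree T.deg = q.dropRight.path.degree T.deg + T.deg q.rightArrow := by
  rw [QPath.degree, q.word_eq_concat, List.map_append, List.sum_append, QPath.degree]
  simp

noncomputable section

variable {K : Type uK} [Field K] [Fintype V]

/-! ### The differential -/

variable (K) in
open Classical in
/-- The differential of a generator. -/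
def dgen (q : T.Gamma (n + 1)) : T.P K n :=
  -- The sign `(-1)^(n+1)` fits powers of special loops too; only the final term, present for their
  -- even powers, is special.
  T.tensor K (T.arr K q.leftArrow) q.dropLeft 1 +
    (-1 : ℤ) ^ (n + 1) • T.tensor K 1 q.dropRight (T.arr K q.rightArrow) -
    if q.rightArrow ∈ T.Sp ∧ Even (n + 1) then T.tensor K 1 q.dropLeft 1 else 0

theorem IsDifferential.apply_generator {d₀ : T.P K 0 →ₗ[T.Env K] T.Alg K}
    {d : ∀ n : ℕ, T.P K (n + 1) →ₗ[T.Env K] T.P K n} (hd : T.IsDifferential K d₀ d)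
    (q : T.Gamma (n + 1)) : d n (T.tensor K 1 q 1) = dgen K q := by
  classical
  by_cases h : q.rightArrow ∈ T.Sp
  · have hq := q.eq_spPow_of_rightArrow h
    generalize q.rightArrow = ε at h hq
    subst hq
    rw [dgen, Gamma.leftArrow_spPow, Gamma.rightArrow_spPow, Gamma.dropLeft_spPow,
      Gamma.dropRight_spPow]
    by_cases he : Even (n + 1)
    · rw [hd.special_even n ε h he, he.neg_one_pow, one_smul, if_pos ⟨h, he⟩]
    · rw [hd.special_odd n ε h (Nat.not_even_iff_odd.1 he),
        (Nat.not_even_iff_odd.1 he).neg_one_pow, neg_one_smul, if_neg fun h => he h.2, sub_zero,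
        sub_eq_add_neg]
  · rw [hd.nonspecial n q fun h' => h (q.mem_rightArrow h'), dgen, if_neg fun h' => h h'.1, sub_zero]

theorem isCompatible_dgen : IsCompatible K (dgen K : T.Gamma (n + 1) → T.P K n) := fun q => by
  classical
  have h₁ : T.idem K q.path.tgt * T.arr K q.leftArrow = T.arr K q.leftArrow := by
    rw [q.path_tgt, idem_mul_arr]
  have h₂ : T.arr K q.rightArrow * T.idem K q.path.src = T.arr K q.rightArrow := by
    rw [q.path_src, arr_mul_idem]
  have h₃ : T.tensor K (T.arr K q.leftArrow) q.dropLeft (T.idem K q.path.src) =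
      T.tensor K (T.arr K q.leftArrow) q.dropLeft 1 := by
    rw [← q.dropLeft_src, tensor_idem_src]
  have h₄ : T.tensor K (T.idem K q.path.tgt) q.dropRight (T.arr K q.rightArrow) =
      T.tensor K 1 q.dropRight (T.arr K q.rightArrow) := by
    rw [← q.dropRight_tgt, tensor_idem_tgt]
  rw [dgen, smul_sub, smul_add, smul_comm _ ((-1 : ℤ) ^ (n + 1)), env_smul_tensor, env_smul_tensor,
    mul_one, one_mul, h₁, h₂, h₃, h₄]
  congr 1
  split_ifs with h
  · rw [env_smul_tensor, mul_one, one_mul, ← q.dropLeft_src, tensor_idem_src,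
      q.dropLeft_eq_dropRight h.1, ← q.dropRight_tgt, tensor_idem_tgt]
  · exact smul_zero _

theorem isCompatible_ofPath : IsCompatible K fun q : T.Gamma 0 => T.ofPath K q.path := fun q => by
  change T.env K _ _ • T.ofPath K q.path = T.ofPath K q.path
  rw [T.env_smul K, idem_mul_ofPath, if_pos rfl, ofPath_mul_idem, if_pos rfl]

theorem exists_isDifferential : ∃ (d₀ : T.P K 0 →ₗ[T.Env K] T.Alg K)
    (d : ∀ n : ℕ, T.P K (n + 1) →ₗ[T.Env K] T.P K n), T.IsDifferential K d₀ d := by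
  classical
  have key : ∀ (n : ℕ) (q : T.Gamma (n + 1)),
      (isCompatible_dgen (K := K) (T := T) (n := n)).desc (T.tensor K 1 q 1) = dgen K q := by
    intro n q
    rw [IsCompatible.desc_tensor, env_one, one_smul]
  refine ⟨isCompatible_ofPath.desc, fun n => isCompatible_dgen.desc, ?_, ?_, ?_, ?_⟩
  · intro q
    rw [IsCompatible.desc_tensor, env_one, one_smul]
  · intro n q hq
    rw [key, dgen, if_neg fun h => q.notMem_rightArrow hq h.1, sub_zero]
  · intro n ε hε hn
    rw [key, dgen, Gamma.leftArrow_spPow, Gamma.rightArrow_spPow, Gamma.dropLeft_spPow,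
      Gamma.dropRight_spPow, hn.neg_one_pow, neg_one_smul,
      if_neg fun h => Nat.not_even_iff_odd.2 hn h.2, sub_zero, sub_eq_add_neg]
  · intro n ε hε hn
    rw [key, dgen, Gamma.leftArrow_spPow, Gamma.rightArrow_spPow, Gamma.dropLeft_spPow,
      Gamma.dropRight_spPow, hn.neg_one_pow, one_smul, if_pos ⟨hε, hn⟩]

theorem dgen_mem_bimodGrading (q : T.Gamma (n + 1)) :
    dgen K q ∈ T.bimodGrading K n (q.path.degree T.deg) := by
  classical
  refine Submodule.sub_mem _ (Submodule.add_mem _ ?_ (zsmul_mem ?_ _)) ?_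
  · exact tensor_mem_bimodGrading _ (arr_mem_algGrading _) one_mem_algGrading
      (by rw [degree_eq_left, add_zero])
  · exact tensor_mem_bimodGrading _ one_mem_algGrading (arr_mem_algGrading _)
      (by rw [degree_eq_right, zero_add])
  · split_ifs with h
    · refine tensor_mem_bimodGrading _ one_mem_algGrading one_mem_algGrading ?_
      rw [degree_eq_left, q.leftArrow_eq_rightArrow h.1, T.deg_special _ h.1, add_zero]
    · exact Submodule.zero_mem _

/-! ### Consecutive differentials compose to zero. -/

section complex

variable {d₀ : T.P K 0 →ₗ[T.Env K] T.Alg K} {d : ∀ n : ℕ, T.P K (n + 1) →ₗ[T.Env K] T.P K n}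

theorem IsDifferential.apply_tensor (hd : T.IsDifferential K d₀ d) (a : T.Alg K)
    (q : T.Gamma (n + 1)) (b : T.Alg K) :
    d n (T.tensor K a q b) = open Classical in
      T.tensor K (a * T.arr K q.leftArrow) q.dropLeft b +
      (-1 : ℤ) ^ (n + 1) • T.tensor K a q.dropRight (T.arr K q.rightArrow * b) -
      if q.rightArrow ∈ T.Sp ∧ Even (n + 1) then T.tensor K a q.dropLeft b else 0 := by
  classical
  rw [tensor_eq_env_smul, map_smul, hd.apply_generator, dgen, smul_sub, smul_add,
    smul_comm _ ((-1 : ℤ) ^ (n + 1)), env_smul_tensor, env_smul_tensor, one_mul, mul_one]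
  congr 1
  split_ifs
  · rw [env_smul_tensor, mul_one, one_mul]
  · exact smul_zero _

theorem IsDifferential.augmentation_tensor (hd : T.IsDifferential K d₀ d) (a : T.Alg K)
    (i : V) (b : T.Alg K) :
    d₀ (T.tensor K a (Gamma.ofVertex T i) b) = a * T.idem K i * b := by
  rw [tensor_eq_env_smul, map_smul, hd.augmentation]
  exact T.env_smul K _ _ _

theorem IsDifferential.apply_ofArrow (hd : T.IsDifferential K d₀ d) (a : T.Alg K) (c : E)
    (b : T.Alg K) : d 0 (T.tensor K a (Gamma.ofArrow T c) b) =
      T.tensor K (a * T.arr K c) (Gamma.ofVertex T (T.Q.src c)) b -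
        T.tensor K a (Gamma.ofVertex T (T.Q.tgt c)) (T.arr K c * b) := by
  have h := hd.apply_tensor a (Gamma.ofArrow T c) b
  rw [if_neg fun h => by simp at h, sub_zero, Odd.neg_one_pow (by simp), neg_one_smul,
    ← sub_eq_add_neg] at h
  exact h

theorem IsDifferential.augmentation_comp (hd : T.IsDifferential K d₀ d) : d₀ ∘ₗ d 0 = 0 :=
  P_hom_ext fun q => by
    rw [q.eq_ofArrow, LinearMap.comp_apply, hd.apply_ofArrow, map_sub,
      hd.augmentation_tensor, hd.augmentation_tensor, one_mul, one_mul, mul_one, mul_one,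
      arr_mul_idem, idem_mul_arr, sub_self]
    rfl

theorem IsDifferential.comp (hd : T.IsDifferential K d₀ d) (n : ℕ) : d n ∘ₗ d (n + 1) = 0 :=
  P_hom_ext fun q => by
    classical
    rw [LinearMap.comp_apply, hd.apply_tensor, LinearMap.zero_apply, one_mul, mul_one]
    by_cases h : q.rightArrow ∈ T.Sp
    -- On powers of `ε`, let `l` and `r` be the commuting idempotent operators inserting `ε` on the
    -- left and on the right; the claim is `(l - r)(l + r - 1) = 0`.
    · have hq := q.eq_spPow_of_rightArrow h
      generalize q.rightArrow = ε at h hq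
      subst hq
      rw [Gamma.leftArrow_spPow, Gamma.dropLeft_spPow, Gamma.dropRight_spPow, map_sub, map_add,
        map_zsmul]
      rw [apply_ite (d n), map_zero]
      simp only [hd.apply_tensor, Gamma.leftArrow_spPow, Gamma.rightArrow_spPow,
        Gamma.dropLeft_spPow, Gamma.dropRight_spPow, arr_mul_self h, h, true_and, one_mul, mul_one]
      rcases Nat.even_or_odd n with hn | hn
      · have h₁ : ¬ Even (n + 1) := by grind
        have h₂ : Even (n + 1 + 1) := by grind
        rw [if_neg h₁, if_neg h₁, if_neg h₁, if_pos h₂, h₂.neg_one_pow,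
          (Nat.not_even_iff_odd.1 h₁).neg_one_pow]
        simp only [one_smul, neg_one_smul]
        abel
      · have h₁ : Even (n + 1) := by grind
        have h₂ : ¬ Even (n + 1 + 1) := by grind
        rw [if_pos h₁, if_pos h₁, if_neg h₂, h₁.neg_one_pow,
          (Nat.not_even_iff_odd.1 h₂).neg_one_pow]
        simp only [one_smul, neg_one_smul]
        abel
    -- Without special letters, the products of the two leftmost and of the two rightmost arrows lie
    -- in `R` and vanish; the two mixed terms cancel by sign.
    · have hl : q.dropLeft.rightArrow ∉ T.Sp := by rwa [q.rightArrow_dropLeft]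
      have hr := q.rightArrow_dropRight_notMem h
      rw [if_neg fun h' => h h'.1, sub_zero, map_add, map_zsmul, hd.apply_tensor, hd.apply_tensor,
        if_neg fun h' => hl h'.1, if_neg fun h' => hr h'.1, sub_zero, sub_zero,
        arr_mul_arr_of_zeroRel (q.rel_left.zeroRel (q.leftArrow_notMem h)),
        arr_mul_arr_of_zeroRel (q.rel_right.zeroRel hr), q.dropLeft_dropRight,
        q.rightArrow_dropLeft, q.leftArrow_dropRight, tensor_zero_left, tensor_zero_right,
        smul_zero, zero_add, add_zero, one_mul, mul_one, pow_succ _ (n + 1), ← add_smul]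
      simp

end complex

end

end Triple

end SkewGentle

namespace SkewGentle

noncomputable section

namespace Triple

variable {K : Type uK} [Field K] {V : Type uV} {E : Type uE} {T : Triple V E} [Fintype V] {n m : ℕ}

/-! ### The contracting homotopy -/

theorem env_smul_env_smul {M : Type*} [AddCommGroup M] [Module (T.Env K) M] (a b c d : T.Alg K)
    (x : M) : T.env K a b • T.env K c d • x = T.env K (a * c) (d * b) • x := by
  rw [smul_smul, env_mul_env]

/-- A family of elements `F γ u`, for a path `u`, that defines a left linear map by
`a ⊗ γ ⊗ u ↦ a F γ u` on normal paths `u`. -/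
structure IsLeftCompatible (F : T.Gamma n → QPath T.Q → T.P K m) : Prop where
  left : ∀ γ p, T.env K (T.idem K γ.path.tgt) 1 • F γ p = F γ p
  right : ∀ γ p, γ.path.src ≠ p.tgt → F γ p = 0

/-- The bilinear maps `(a, u) ↦ a F γ u`. -/
def leftAux (F : T.Gamma n → QPath T.Q → T.P K m) (γ : T.Gamma n) :
    T.Alg K →ₗ[K] T.Alg K →ₗ[K] T.P K m :=
  -- Passing through `nf` makes this well defined on `A` without asking `F` to respect the
  -- relations.
  LinearMap.mk₂ K (fun a b => T.env K a 1 • PathAlgebra.extend (F γ) (T.nf K b))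
    (fun a a' b => by rw [env_add_left, add_smul])
    (fun c a b => by rw [env_smul_left, smul_assoc])
    (fun a b b' => by rw [map_add, map_add, smul_add])
    (fun c a b => by rw [map_smul, map_smul, smul_algebra_smul_comm])

variable {F : T.Gamma n → QPath T.Q → T.P K m}

theorem IsLeftCompatible.env_idem_smul (hF : IsLeftCompatible F) (γ : T.Gamma n) (a : T.Alg K)
    (x : PathAlgebra K T.Q) (i : V) :
    T.env K (a * T.idem K i) 1 • PathAlgebra.extend (F γ) x = open Classical in
      if γ.path.tgt = i then T.env K a 1 • PathAlgebra.extend (F γ) x else 0 := by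
  classical
  have h : T.env K (T.idem K γ.path.tgt) 1 • PathAlgebra.extend (F γ) x =
      PathAlgebra.extend (F γ) x := by
    have h' : Algebra.lsmul K K (T.P K m) (T.env K (T.idem K γ.path.tgt) 1) ∘ₗ
        PathAlgebra.extend (F γ) = PathAlgebra.extend (F γ) :=
      PathAlgebra.hom_ext fun p => by
        simp only [LinearMap.comp_apply, PathAlgebra.extend_ofPath]
        exact hF.left γ p
    exact LinearMap.congr_fun h' x
  rw [← h, env_smul_env_smul, env_smul_env_smul, mul_assoc]
  split_ifs with hi
  · rw [hi, idem_mul_self]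
  · rw [idem_mul_of_ne (Ne.symm hi), mul_zero, env_zero_left]
    exact zero_smul (T.Env K) (PathAlgebra.extend (F γ) x)

theorem IsLeftCompatible.extend_vertOp (hF : IsLeftCompatible F) (γ : T.Gamma n) (i : V)
    (x : PathAlgebra K T.Q) : PathAlgebra.extend (F γ) (T.vertOp K i x) = open Classical in
      if γ.path.src = i then PathAlgebra.extend (F γ) x else 0 := by
  classical
  have h' : PathAlgebra.extend (F γ) ∘ₗ T.vertOp K i =
      if γ.path.src = i then PathAlgebra.extend (F γ) else 0 :=
    PathAlgebra.hom_ext fun p => by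
      rw [LinearMap.comp_apply, vertOp_ofPath]
      by_cases h₁ : γ.path.src = i
      · rw [if_pos h₁]
        split_ifs with h₂
        · rfl
        · rw [map_zero, PathAlgebra.extend_ofPath, hF.right γ p (h₁ ▸ h₂)]
      · rw [if_neg h₁, LinearMap.zero_apply]
        split_ifs with h₂
        · rw [PathAlgebra.extend_ofPath, hF.right γ p (h₂ ▸ h₁)]
        · exact map_zero _
  refine (LinearMap.congr_fun h' x).trans ?_
  split_ifs <;> rfl

theorem IsLeftCompatible.isBalanced (hF : IsLeftCompatible F) : IsBalanced (leftAux F) where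
  left γ a b i := hF.env_idem_smul γ a _ i
  right γ a b i := by
    change T.env K a 1 • PathAlgebra.extend (F γ) (T.nf K (T.idem K i * b)) = _
    rw [nf_idem_mul, hF.extend_vertOp, smul_ite, smul_zero]
    rfl

/-- The left linear map `a ⊗ γ ⊗ u ↦ a F γ u`. -/
def IsLeftCompatible.lift (hF : IsLeftCompatible F) : T.P K n →ₗ[K] T.P K m := hF.isBalanced.lift

theorem IsLeftCompatible.lift_tensor (hF : IsLeftCompatible F) (a : T.Alg K) (γ : T.Gamma n)
    (b : T.Alg K) :
    hF.lift (T.tensor K a γ b) = T.env K a 1 • PathAlgebra.extend (F γ) (T.nf K b) :=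
  hF.isBalanced.lift_tensor a γ b

theorem IsLeftCompatible.lift_normal (hF : IsLeftCompatible F) (a : T.Alg K) (γ : T.Gamma n)
    {u : QPath T.Q} (hu : T.IsNormal K u) :
    hF.lift (T.tensor K a γ (T.ofPath K u)) = T.env K a 1 • F γ u := by
  rw [hF.lift_tensor, hu, PathAlgebra.extend_ofPath]

theorem IsLeftCompatible.lift_arr_mul (hF : IsLeftCompatible F) (γ : T.Gamma n) (c : E)
    {u : QPath T.Q} (hu : T.IsNormal K u) :
    hF.lift (T.tensor K 1 γ (T.arr K c * T.ofPath K u)) =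
      PathAlgebra.extend (F γ) (T.consNF K c u) := by
  rw [hF.lift_tensor, nf_arr_mul, hu, leftOp_ofPath, env_one, one_smul]

theorem IsLeftCompatible.lift_smul (hF : IsLeftCompatible F) (a : T.Alg K) (x : T.P K n) :
    hF.lift (T.env K a 1 • x) = T.env K a 1 • hF.lift x := by
  induction x using P_induction with
  | zero => rw [smul_zero, map_zero, smul_zero]
  | add x y hx hy => rw [smul_add, map_add, map_add, hx, hy, smul_add]
  | tensor c γ b =>
    rw [env_smul_tensor, hF.lift_tensor, hF.lift_tensor, env_smul_env_smul, mul_one, mul_one]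

/-- A left linear endomorphism is the identity if it is so on the elements `1 ⊗ γ ⊗ u` for
normal paths `u` composable with `γ`. -/
theorem eq_id_of_normal {g : T.P K n →ₗ[K] T.P K n}
    (hg : ∀ a x, g (T.env K a 1 • x) = T.env K a 1 • g x)
    (h : ∀ (γ : T.Gamma n) (u : QPath T.Q), T.IsNormal K u → γ.path.src = u.tgt →
      g (T.tensor K 1 γ (T.ofPath K u)) = T.tensor K 1 γ (T.ofPath K u)) (x : T.P K n) :
    g x = x := by
  induction x using P_induction with
  | zero => exact map_zero _
  | add x y hx hy => rw [map_add, hx, hy]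
  | tensor a γ b =>
    have h₁ : T.tensor K a γ b = T.env K a 1 • T.tensor K 1 γ b := by simp
    rw [h₁, hg]
    congr 1
    have h₂ : g ∘ₗ tensorₗ K γ 1 = tensorₗ K γ 1 := hom_ext_normal fun u hu => by
      by_cases hc : γ.path.src = u.tgt
      · exact h γ u hu hc
      · rw [LinearMap.comp_apply, tensorₗ_apply, tensor_ofPath_of_ne γ 1 u hc, map_zero]
    exact LinearMap.congr_fun h₂ b

variable (K T) in
/-- The sum of `v ⊗ c ⊗ w` over the factorizations `v c w` of a word. -/
def wordDer : List E → V → T.P K 1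
  | [], _ => 0
  | a :: l, i => T.env K (T.arr K a) 1 • wordDer l i +
      -- For empty `l` the idempotent supplies the trivial path; in general the right factor is the
      -- class of the remaining path, by `ofPath_eq_prod`.
      T.tensor K 1 (Gamma.ofArrow T a) ((l.map (T.arr K)).prod * T.idem K i)

variable (K) in
/-- The sum of `v ⊗ c ⊗ w` over the factorizations `v c w` of a path. -/
def pathDer (p : QPath T.Q) : T.P K 1 := T.wordDer K p.word p.src

theorem ofPath_eq_prod (p : QPath T.Q) :
    T.ofPath K p = (p.word.map (T.arr K)).prod * T.idem K p.src := by
  induction p using QPath.cons_induction with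
  | triv i => exact (one_mul _).symm
  | cons a p h ih =>
    rw [← arr_mul_ofPath, ih, ← mul_assoc]
    rfl

theorem pathDer_triv (i : V) : pathDer K (QPath.triv T.Q i) = 0 := rfl

theorem pathDer_cons (a : E) (p : QPath T.Q) (h : T.Q.src a = p.tgt) :
    pathDer K (QPath.cons a p h) = T.env K (T.arr K a) 1 • pathDer K p +
      T.tensor K 1 (Gamma.ofArrow T a) (T.ofPath K p) := by
  rw [ofPath_eq_prod]
  rfl

theorem idem_smul_pathDer (p : QPath T.Q) :
    T.env K (T.idem K p.tgt) 1 • pathDer K p = pathDer K p := by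
  induction p using QPath.cons_induction with
  | triv i => rw [pathDer_triv, smul_zero]
  | cons a p h ih =>
    rw [pathDer_cons, smul_add, env_smul_env_smul, env_smul_tensor]
    change T.env K (T.idem K (T.Q.tgt a) * T.arr K a) _ • _ + T.tensor K (T.idem K (T.Q.tgt a) * 1)
      _ _ = _
    have := tensor_idem_tgt (K := K) (Gamma.ofArrow T a) (T.ofPath K p)
    rw [idem_mul_arr, mul_one, mul_one, mul_one]
    congr 1

variable (K) in
open Classical in
/-- The homotopy in degree zero on `1 ⊗ γ ⊗ p`. -/
def vertexHtpy (γ : T.Gamma 0) (p : QPath T.Q) : T.P K 1 :=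
  -- The sign is dictated by `d_1 (pathDer p) = p ⊗ 1 - 1 ⊗ p`, because `1 ⊗ p` has to be recovered
  -- from `p ⊗ 1`.
  if γ.path.src = p.tgt then -pathDer K p else 0

theorem isLeftCompatible_vertexHtpy : IsLeftCompatible (vertexHtpy K : T.Gamma 0 → _ → _) where
  left γ p := by
    classical
    rw [vertexHtpy]
    split_ifs with h
    · have : γ.path.tgt = p.tgt := by
        rw [γ.eq_ofVertex] at h ⊢
        exact h
      rw [this, smul_neg, idem_smul_pathDer]
    · exact smul_zero _
  right γ p h := if_neg h

variable (K) in
open Classical in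
/-- The homotopy in positive degrees on `1 ⊗ γ ⊗ p`. -/
def arrowHtpy (γ : T.Gamma (n + 1)) (p : QPath T.Q) : T.P K (n + 2) :=
  -- For a dead loop `d (1 ⊗ ε^(n+2) ⊗ 1)` is `-1 ⊗ ε^(n+1) ⊗ 1` for even `n` and `0` for odd `n`.
  -- The homotopy inverts the nonzero maps and uses up no letter of `p`.
  if hd : T.Dead γ.rightArrow then
    if Even n then -T.tensor K 1 (γ.snoc γ.rightArrow (rel_self hd.1)) (T.ofPath K p) else 0
  else if h : ∃ b, p.word.head? = some b ∧ T.Rel γ.rightArrow b then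
    -- This sign cancels the `(-1)^(n+2)` of the term of the differential that moves `b` back to the
    -- right factor.
    (-1 : ℤ) ^ n • T.tensor K 1 (γ.snoc h.choose h.choose_spec.2) (T.ofPath K p.dropLeft)
  else 0

theorem arrowHtpy_dead_even (γ : T.Gamma (n + 1)) (p : QPath T.Q) (hd : T.Dead γ.rightArrow)
    (hn : Even n) : arrowHtpy K γ p =
      -T.tensor K 1 (γ.snoc γ.rightArrow (rel_self hd.1)) (T.ofPath K p) := by
  rw [arrowHtpy, dif_pos hd, if_pos hn]

theorem arrowHtpy_dead_odd (γ : T.Gamma (n + 1)) (p : QPath T.Q) (hd : T.Dead γ.rightArrow)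
    (hn : ¬ Even n) : arrowHtpy K γ p = 0 := by
  rw [arrowHtpy, dif_pos hd, if_neg hn]

theorem arrowHtpy_cons (γ : T.Gamma (n + 1)) (b : E) (p : QPath T.Q) (hb : T.Q.src b = p.tgt)
    (hd : ¬ T.Dead γ.rightArrow) (h : T.Rel γ.rightArrow b) :
    arrowHtpy K γ (QPath.cons b p hb) =
      (-1 : ℤ) ^ n • T.tensor K 1 (γ.snoc b h) (T.ofPath K p) := by
  have h' : ∃ c, (QPath.cons b p hb).word.head? = some c ∧ T.Rel γ.rightArrow c := ⟨b, rfl, h⟩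
  rw [arrowHtpy, dif_neg hd, dif_pos h', QPath.dropLeft_cons]
  have hc : h'.choose = b := h'.choose_spec.2.eq_right h
  congr 2
  exact Gamma.ext_word (by rw [Gamma.snoc_word, Gamma.snoc_word, hc])

theorem arrowHtpy_of_not_rel (γ : T.Gamma (n + 1)) (p : QPath T.Q) (hd : ¬ T.Dead γ.rightArrow)
    (h : ¬ ∃ b, p.word.head? = some b ∧ T.Rel γ.rightArrow b) : arrowHtpy K γ p = 0 := by
  rw [arrowHtpy, dif_neg hd, dif_neg h]

theorem isLeftCompatible_arrowHtpy :
    IsLeftCompatible (arrowHtpy K : T.Gamma (n + 1) → _ → _) where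
  left γ p := by
    classical
    have key : ∀ b h x, T.env K (T.idem K γ.path.tgt) 1 • T.tensor K 1 (γ.snoc b h) x =
        T.tensor K 1 (γ.snoc b h) x := by
      intro b h x
      rw [env_smul_tensor, mul_one, mul_one, ← γ.path_tgt_snoc b h, tensor_idem_tgt]
    rw [arrowHtpy]
    split_ifs
    · rw [smul_neg, key]
    · exact smul_zero _
    · rw [smul_comm, key]
    · exact smul_zero _
  right γ p hp := by
    classical
    rw [arrowHtpy]
    split_ifs with hd hn h
    · rw [tensor_ofPath_of_ne, neg_zero]
      rw [Gamma.path_src, Gamma.rightArrow_snoc, ← Gamma.path_src]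
      exact hp
    · rfl
    · obtain ⟨b, hb, hr⟩ := h
      exact absurd (γ.path_src.trans (hr.1.trans (QPath.tgt_eq_of_head? hb).symm)) hp
    · rfl

/-! ### The homotopy identities and exactness. -/

section complex

variable {d₀ : T.P K 0 →ₗ[T.Env K] T.Alg K} {d : ∀ n : ℕ, T.P K (n + 1) →ₗ[T.Env K] T.P K n}

/-- Supplies the left linearity of `ds + sd` that `eq_id_of_normal` needs; the homotopies are not
asserted to be right linear. -/
theorem lift_differential_smul (hF : IsLeftCompatible F) (f : T.P K m →ₗ[T.Env K] T.P K n)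
    {k : ℕ} {G : T.Gamma k → QPath T.Q → T.P K n} (hG : IsLeftCompatible G)
    (g : T.P K n →ₗ[T.Env K] T.P K k) (a : T.Alg K) (x : T.P K n) :
    (f.restrictScalars K ∘ₗ hF.lift + hG.lift ∘ₗ g.restrictScalars K) (T.env K a 1 • x) =
      T.env K a 1 • (f.restrictScalars K ∘ₗ hF.lift + hG.lift ∘ₗ g.restrictScalars K) x := by
  simp only [LinearMap.add_apply, LinearMap.comp_apply, LinearMap.restrictScalars_apply, map_smul,
    hF.lift_smul, hG.lift_smul, smul_add]

theorem IsDifferential.apply_arrowHtpy_dead (hd : T.IsDifferential K d₀ d) (γ : T.Gamma (n + 1))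
    (p : QPath T.Q) (hdead : T.Dead γ.rightArrow) (hn : Even n) :
    d (n + 1) (arrowHtpy K γ p) = T.tensor K 1 γ (T.ofPath K p) := by
  have hn' : Even (n + 1 + 1) := by grind
  rw [arrowHtpy_dead_even _ _ hdead hn, map_neg, hd.apply_tensor,
    Gamma.dropLeft_snoc_self _ hdead.1, Gamma.leftArrow_snoc, Gamma.rightArrow_snoc,
    γ.leftArrow_eq_rightArrow hdead.1, arr_eq_zero_of_dead hdead, if_pos ⟨hdead.1, hn'⟩, mul_zero,
    zero_mul, tensor_zero_left, tensor_zero_right, smul_zero, zero_add, zero_sub, neg_neg]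

/-- Splitting `b` off `γb` again restores `1 ⊗ γ ⊗ bp` with sign `+1`; the other terms are those
that `sd` has to cancel. -/
theorem IsDifferential.apply_arrowHtpy_cons (hd : T.IsDifferential K d₀ d) (γ : T.Gamma (n + 1))
    (b : E) (p : QPath T.Q) (hb : T.Q.src b = p.tgt) (hdead : ¬ T.Dead γ.rightArrow)
    (h : T.Rel γ.rightArrow b) :
    d (n + 1) (arrowHtpy K γ (QPath.cons b p hb)) = open Classical in
      (-1 : ℤ) ^ n • T.tensor K (T.arr K γ.leftArrow) (γ.snoc b h).dropLeft (T.ofPath K p) +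
      T.tensor K 1 γ (T.ofPath K (QPath.cons b p hb)) -
      if b ∈ T.Sp ∧ Even n then T.tensor K 1 (γ.snoc b h).dropLeft (T.ofPath K p) else 0 := by
  classical
  have hn' : Even (n + 1 + 1) ↔ Even n := by grind
  rw [arrowHtpy_cons γ b p hb hdead h, map_zsmul, hd.apply_tensor, Gamma.dropRight_snoc,
    Gamma.leftArrow_snoc, Gamma.rightArrow_snoc, arr_mul_ofPath _ _ hb, one_mul]
  simp only [hn']
  rw [smul_sub, smul_add, smul_smul, ← pow_add, Even.neg_one_pow (n := n + (n + 1 + 1)) (by grind),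
    one_smul]
  congr 1
  split_ifs with h'
  · rw [h'.2.neg_one_pow, one_smul]
  · exact smul_zero _

/-- The homotopy identity in degree one. -/
theorem IsDifferential.htpy_one (hd : T.IsDifferential K d₀ d) (x : T.P K 1) :
    d 1 (isLeftCompatible_arrowHtpy.lift x) + isLeftCompatible_vertexHtpy.lift (d 0 x) = x := by
  classical
  refine eq_id_of_normal (lift_differential_smul isLeftCompatible_arrowHtpy (d 1)
    isLeftCompatible_vertexHtpy (d 0)) (fun γ u hu hc => ?_) x
  change d 1 (isLeftCompatible_arrowHtpy.lift (T.tensor K 1 γ _)) +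
    isLeftCompatible_vertexHtpy.lift (d 0 (T.tensor K 1 γ _)) = _
  have hl : vertexHtpy K γ.dropLeft u = -pathDer K u := if_pos (γ.dropLeft_src.trans hc)
  have hr : ∀ p : QPath T.Q, p.tgt = T.Q.tgt γ.rightArrow →
      vertexHtpy K γ.dropRight p = -pathDer K p := fun p hp => if_pos (γ.dropRight_src.trans hp.symm)
  rw [hd.apply_tensor, if_neg fun h => by simp at h, sub_zero, Odd.neg_one_pow (by simp),
    neg_one_smul, map_add, map_neg, IsLeftCompatible.lift_normal _ _ _ hu,
    IsLeftCompatible.lift_normal _ _ _ hu, IsLeftCompatible.lift_arr_mul _ _ _ hu, env_one, one_smul,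
    one_mul, hl, smul_neg, γ.leftArrow_one]
  -- For a dead loop the arrow is zero in `A`, so `sd` vanishes and `ds` alone is the identity.
  by_cases hdead : T.Dead γ.rightArrow
  · rw [hd.apply_arrowHtpy_dead γ u hdead Even.zero, consNF_of_dead hdead, map_zero, neg_zero,
      add_zero, arr_eq_zero_of_dead hdead, env_zero_left, add_eq_left, neg_eq_zero]
    exact zero_smul (T.Env K) (pathDer K u)
  by_cases h : ∃ b, u.word.head? = some b ∧ T.Rel γ.rightArrow b
  · obtain ⟨b, hb, hrel⟩ := h
    obtain ⟨l, hl⟩ := List.head?_eq_some_iff.1 hb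
    obtain ⟨u', hb', rfl⟩ := QPath.eq_cons_of_word hl
    rw [hd.apply_arrowHtpy_cons γ b u' hb' hdead hrel, γ.dropLeft_snoc_one, pathDer_cons, smul_add,
      env_smul_env_smul, env_smul_tensor, mul_one, mul_one, mul_one, pow_zero, one_smul,
      γ.leftArrow_one]
    -- If the arrow is special then `b` equals it, it fixes `u`, and the Leibniz terms cancel
    -- against the extra term of `d_2`. Otherwise its product with `b` lies in `R` and it kills `u`.
    by_cases hs : γ.rightArrow ∈ T.Sp
    · obtain rfl := hrel.eq_of_left_mem hs
      rw [consNF_self hs hdead, PathAlgebra.extend_ofPath, hr _ rfl, pathDer_cons,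
        if_pos ⟨hs, Even.zero⟩, arr_mul_self hs]
      abel
    · have hbs : b ∉ T.Sp := fun h' => hs ((hrel.eq_of_right_mem h').symm ▸ h')
      rw [consNF_of_rel_notMem hrel hs, map_zero, if_neg fun h' => hbs h'.1,
        arr_mul_arr_of_zeroRel (hrel.zeroRel hs), env_zero_left,
        show (0 : T.Env K) • pathDer K u' = 0 from zero_smul (T.Env K) (pathDer K u')]
      abel
  -- Now `s` vanishes on `1 ⊗ γ ⊗ u` and no rewriting occurs in the product of the arrow with `u`,
  -- so the Leibniz rule `pathDer_cons` leaves exactly `1 ⊗ γ ⊗ u`.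
  · have hc' : T.Q.src γ.rightArrow = u.tgt := γ.path_src.symm.trans hc
    rw [arrowHtpy_of_not_rel γ u hdead h, map_zero, consNF_of_not_rel hdead u hc' h,
      PathAlgebra.extend_ofPath, hr _ rfl, pathDer_cons, ← γ.eq_ofArrow]
    abel

/-- The homotopy identity in degrees at least two. -/
theorem IsDifferential.htpy_succ (hd : T.IsDifferential K d₀ d) (x : T.P K (n + 2)) :
    d (n + 2) (isLeftCompatible_arrowHtpy.lift x) +
      isLeftCompatible_arrowHtpy.lift (d (n + 1) x) = x := by
  classical
  refine eq_id_of_normal (lift_differential_smul isLeftCompatible_arrowHtpy (d (n + 2))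
    isLeftCompatible_arrowHtpy (d (n + 1))) (fun γ u hu hc => ?_) x
  change d (n + 2) (isLeftCompatible_arrowHtpy.lift (T.tensor K 1 γ _)) +
    isLeftCompatible_arrowHtpy.lift (d (n + 1) (T.tensor K 1 γ _)) = _
  have hn' : Even (n + 1 + 1) ↔ Even n := by grind
  have hrl : γ.dropLeft.rightArrow = γ.rightArrow := γ.rightArrow_dropLeft
  rw [hd.apply_tensor, map_sub, map_add, map_zsmul, apply_ite (IsLeftCompatible.lift _), map_zero,
    IsLeftCompatible.lift_normal _ _ _ hu, IsLeftCompatible.lift_normal _ _ _ hu,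
    IsLeftCompatible.lift_normal _ _ _ hu, IsLeftCompatible.lift_arr_mul _ _ _ hu, env_one, one_smul,
    one_smul, one_mul]
  simp only [hn']
  by_cases hdead : T.Dead γ.rightArrow
  · have hdead' : T.Dead γ.dropLeft.rightArrow := hrl.symm ▸ hdead
    rw [consNF_of_dead hdead, map_zero, smul_zero, add_zero, γ.leftArrow_eq_rightArrow hdead.1,
      arr_eq_zero_of_dead hdead, env_zero_left,
      show (0 : T.Env K) • arrowHtpy K γ.dropLeft u = 0 from
        zero_smul (T.Env K) (arrowHtpy K γ.dropLeft u), zero_sub]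
    -- On dead loops the homotopy is nonzero only in alternate degrees: `sd` gives the identity for
    -- even `n`, and `ds` for odd `n`.
    by_cases hn : Even n
    · rw [arrowHtpy_dead_odd γ u hdead (by grind), map_zero, zero_add, if_pos ⟨hdead.1, hn⟩,
        arrowHtpy_dead_even _ u hdead' hn, neg_neg]
      congr 1
      refine Gamma.ext_word ?_
      rw [Gamma.snoc_word, γ.dropLeft_eq_dropRight hdead.1, γ.word_eq_concat,
        ← γ.dropLeft_eq_dropRight hdead.1, hrl]
    · rw [hd.apply_arrowHtpy_dead γ u hdead (by grind), if_neg fun h => hn h.2, neg_zero, add_zero]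
  have hdead' : ¬ T.Dead γ.dropLeft.rightArrow := hrl.symm ▸ hdead
  by_cases h : ∃ b, u.word.head? = some b ∧ T.Rel γ.rightArrow b
  · obtain ⟨b, hb, hrel⟩ := h
    obtain ⟨l, hl⟩ := List.head?_eq_some_iff.1 hb
    obtain ⟨u', hb', rfl⟩ := QPath.eq_cons_of_word hl
    have hrel' : T.Rel γ.dropLeft.rightArrow b := hrl.symm ▸ hrel
    rw [hd.apply_arrowHtpy_cons γ b u' hb' hdead hrel, γ.dropLeft_snoc,
      arrowHtpy_cons γ.dropLeft b u' hb' hdead' hrel', smul_comm, env_smul_tensor, mul_one, mul_one,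
      pow_succ (-1 : ℤ) n, mul_neg_one, neg_smul]
    -- In the special case `u` is fixed by the loop, and the right-hand term of `d` followed by `s`
    -- leaves an unwanted summand. It is cancelled by the extra term of `d_{n+2}` for even `n` and
    -- by that of `d_{n+3}` for odd `n`.
    by_cases hs : γ.rightArrow ∈ T.Sp
    · obtain rfl := hrel.eq_of_left_mem hs
      rw [consNF_self hs hdead, PathAlgebra.extend_ofPath, ← γ.dropLeft_eq_dropRight hs,
        arrowHtpy_cons γ.dropLeft _ u' hb' hdead' hrel', smul_smul, ← pow_add]
      by_cases hn : Even n
      · rw [if_neg (by grind), if_pos ⟨hs, hn⟩, hn.neg_one_pow, Even.neg_one_pow (by grind)]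
        abel
      · rw [if_pos (by grind), if_neg (by grind), (Nat.not_even_iff_odd.1 hn).neg_one_pow,
          Even.neg_one_pow (by grind)]
        simp only [one_smul, neg_one_smul]
        abel
    · have hbs : b ∉ T.Sp := fun h' => hs ((hrel.eq_of_right_mem h').symm ▸ h')
      rw [consNF_of_rel_notMem hrel hs, map_zero, smul_zero, if_neg fun h' => hbs h'.1,
        if_neg fun h' => hs h'.1]
      abel
  -- Here `s` vanishes on `1 ⊗ γ ⊗ u`, but the differential moves the last arrow of `γ` to the front
  -- of `u`, and `s` attaches it again to recover `γ`.
  · have hc' : T.Q.src γ.rightArrow = u.tgt := γ.path_src.symm.trans hc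
    have hdead'' : ¬ T.Dead γ.dropRight.rightArrow := fun h' => hdead (by
      rw [γ.rel_right.eq_of_left_mem h'.1]
      exact h')
    rw [arrowHtpy_of_not_rel γ u hdead h, map_zero, consNF_of_not_rel hdead u hc' h,
      PathAlgebra.extend_ofPath, arrowHtpy_cons γ.dropRight _ u hc' hdead'' γ.rel_right,
      γ.snoc_dropRight, arrowHtpy_of_not_rel γ.dropLeft u hdead' (hrl.symm ▸ h), smul_zero,
      ite_self, smul_smul, ← pow_add, Even.neg_one_pow (by grind), one_smul]
    abel

variable (K T) in
/-- The homotopy `b ↦ b ⊗ 1` in degree `-1`. -/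
def augHtpy : T.Alg K →ₗ[K] T.P K 0 := ∑ i : V, (tensorₗ K (Gamma.ofVertex T i)).flip 1

theorem augHtpy_apply (b : T.Alg K) :
    T.augHtpy K b = ∑ i : V, T.tensor K b (Gamma.ofVertex T i) 1 := by
  rw [augHtpy, LinearMap.sum_apply]
  rfl

theorem augHtpy_mul (a b : T.Alg K) : T.augHtpy K (a * b) = T.env K a 1 • T.augHtpy K b := by
  simp only [augHtpy_apply, Finset.smul_sum, env_smul_tensor, mul_one]

theorem augHtpy_idem (i : V) : T.augHtpy K (T.idem K i) = T.tensor K 1 (Gamma.ofVertex T i) 1 := by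
  classical
  rw [augHtpy_apply, Finset.sum_eq_single i]
  · exact tensor_idem_tgt (Gamma.ofVertex T i) 1
  · intro j _ hj
    rw [← one_mul (T.idem K i), tensor_mul_idem]
    exact if_neg hj
  · exact fun h => absurd (Finset.mem_univ i) h

theorem IsDifferential.augmentation_augHtpy (hd : T.IsDifferential K d₀ d) (b : T.Alg K) :
    d₀ (T.augHtpy K b) = b := by
  rw [augHtpy_apply, map_sum]
  simp only [hd.augmentation_tensor, mul_one]
  rw [← Finset.mul_sum, sum_idem, mul_one]

/-- A telescoping sum: `v ⊗ c ⊗ w` is sent to `vc ⊗ w - v ⊗ cw`, so only the two extreme cuts of `p`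
survive. -/
theorem IsDifferential.apply_pathDer (hd : T.IsDifferential K d₀ d) (p : QPath T.Q) :
    d 0 (pathDer K p) =
      T.augHtpy K (T.ofPath K p) - T.tensor K 1 (Gamma.ofVertex T p.tgt) (T.ofPath K p) := by
  induction p using QPath.cons_induction with
  | triv i =>
    change d 0 0 = T.augHtpy K (T.idem K i) - T.tensor K 1 (Gamma.ofVertex T i) (T.idem K i)
    have := tensor_idem_src (K := K) (Gamma.ofVertex T i) 1
    change T.tensor K 1 _ (T.idem K i) = _ at this
    rw [this, augHtpy_idem, sub_self, map_zero]
  | cons a p h ih =>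
    rw [pathDer_cons, map_add, map_smul, ih, hd.apply_ofArrow, ← arr_mul_ofPath, augHtpy_mul,
      smul_sub, env_smul_tensor, one_mul, mul_one, mul_one, h]
    change _ = _ - T.tensor K 1 (Gamma.ofVertex T (T.Q.tgt a)) _
    abel

/-- The homotopy identity in degree zero. -/
theorem IsDifferential.htpy_zero (hd : T.IsDifferential K d₀ d) (x : T.P K 0) :
    d 0 (isLeftCompatible_vertexHtpy.lift x) + T.augHtpy K (d₀ x) = x := by
  refine eq_id_of_normal (g := (d 0).restrictScalars K ∘ₗ isLeftCompatible_vertexHtpy.lift +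
    T.augHtpy K ∘ₗ d₀.restrictScalars K) (fun a x => ?_) (fun γ u hu hc => ?_) x
  · simp only [LinearMap.add_apply, LinearMap.comp_apply, LinearMap.restrictScalars_apply, map_smul,
      IsLeftCompatible.lift_smul, smul_add]
    rw [T.env_smul K, mul_one, augHtpy_mul]
  · obtain ⟨i, rfl⟩ : ∃ i, γ = Gamma.ofVertex T i := ⟨_, γ.eq_ofVertex⟩
    have hc : i = u.tgt := hc
    subst hc
    change d 0 (isLeftCompatible_vertexHtpy.lift (T.tensor K 1 _ _)) +
      T.augHtpy K (d₀ (T.tensor K 1 _ _)) = _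
    rw [IsLeftCompatible.lift_normal _ _ _ hu, env_one, one_smul, hd.augmentation_tensor, one_mul,
      idem_mul_ofPath, if_pos rfl, show vertexHtpy K (Gamma.ofVertex T u.tgt) u = -pathDer K u from
        if_pos rfl, map_neg, hd.apply_pathDer]
    abel

/-- The homotopy identities write a cycle `x` as `d (s x)`; the other inclusion is the vanishing of
consecutive composites. Homogeneity is checked on generators. -/
theorem IsDifferential.isGradedProjectiveResolution (hd : T.IsDifferential K d₀ d) :
    IsGradedProjectiveResolution.{w} (T.algGrading K) (T.algGrading K) (T.bimodGrading K) d₀ d where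
  target_graded := isGradedBimod_algGrading K T
  gradedProjective n := isGradedProjective_bimodGrading K T n
  augmentation_degree := preservesGrading_of_generators (isGradedBimod_algGrading K T) d₀ fun γ => by
    rw [hd.augmentation]
    exact ofPath_mem_algGrading _
  differential_degree n :=
    preservesGrading_of_generators (isGradedBimod_bimodGrading K T n) (d n) fun γ => by
      rw [hd.apply_generator]
      exact dgen_mem_bimodGrading γ
  surjective b := ⟨T.augHtpy K b, hd.augmentation_augHtpy b⟩
  exact_zero x := by
    refine ⟨fun hx => ⟨isLeftCompatible_vertexHtpy.lift x, ?_⟩, ?_⟩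
    · have := hd.htpy_zero x
      rwa [hx, map_zero, add_zero] at this
    · rintro ⟨y, rfl⟩
      exact LinearMap.congr_fun hd.augmentation_comp y
  exact_succ n x := by
    refine ⟨fun hx => ⟨isLeftCompatible_arrowHtpy.lift x, ?_⟩, ?_⟩
    · cases n with
      | zero =>
        have := hd.htpy_one x
        rwa [hx, map_zero, add_zero] at this
      | succ n =>
        have := hd.htpy_succ x
        rwa [hx, map_zero, add_zero] at this
    · rintro ⟨y, rfl⟩
      exact LinearMap.congr_fun (hd.comp n) y

end complex

end Triple

end

end SkewGentle

theorem mainTheorem8 {K : Type uK} [Field K] {V : Type uV} {E : Type uE} [Fintype V] [Finite E]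
    (T : SkewGentle.Triple V E) :
    SkewGentle.IsGradedAlg (T.algGrading K) ∧
    (∃ (d₀ : T.P K 0 →ₗ[T.Env K] T.Alg K) (d : ∀ n : ℕ, T.P K (n + 1) →ₗ[T.Env K] T.P K n),
      T.IsDifferential K d₀ d) ∧
    ∀ (d₀ : T.P K 0 →ₗ[T.Env K] T.Alg K) (d : ∀ n : ℕ, T.P K (n + 1) →ₗ[T.Env K] T.P K n),
      T.IsDifferential K d₀ d →
      SkewGentle.IsGradedProjectiveResolution.{w} (T.algGrading K) (T.algGrading K) (T.bimodGrading K)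
        d₀ d :=
  ⟨SkewGentle.Triple.isGradedAlg_algGrading K T, SkewGentle.Triple.exists_isDifferential,
    fun _ _ hd => hd.isGradedProjectiveResolution⟩
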